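/- **Definitions.** Let $v\ge 1$, and for $\vec n=(n_1,n_2,n_3)$ consider the periodic $n_1\times n_2\times n_3$ cubic lattice whose sites (composite particles) $P_{r_1,r_2,r_3}$, $1\le r_m\le n_m$, carry $v$ qubits each, so that there are $N=v\,n_1n_2n_3$ qubits. Let $\mathcal P=\langle iI,X_1,Z_1,\dots,X_N,Z_N\rangle$ be the Pauli group, and let $T_m$ be the unit translation of composite particles in direction $m$. A *three-dimensional STS model* is a collection of Pauli operators (interaction terms), each supported on a block of $2\times2\times2$ composite particles and independent of $\vec n$, such that, for all system sizes $\vec n$ (with all $n_m\ge 2$, so that a block fits in the torus), the group $\mathcal S=\mathcal S_{\vec n}$ generated by all translates of the interaction terms on the torus is Abelian, does not contain $-I$, and the number of logical qubits $k=N-G(\mathcal S)$ does not depend on $\vec n$. Here $G(\mathcal S)$ is the number of independent generators of $\mathcal S$. (If some $n_m=1$, the interaction terms are wrapped around the torus in direction $m$, and $\mathcal S$ is again the group generated by all translates of the wrapped terms.) The centralizer group $\mathcal C$ consists of all $U\in\mathcal P$ that commute with every element of $\mathcal S$. A logical operator is a $U\in\mathcal C$ with $U^2=I$ and $U\notin\mathcal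 S$. We write $U\sim W$ if $U^{-1}W\in\mathcal S$. Put $P(x_1,x_2,x_3)=\{P_{r_1,r_2,r_3}: 1\le r_m\le x_m,\ m=1,2,3\}$, and for a set $R$ of composite particles let $\mathcal C_R$ be the set of elements of $\mathcal C$ supported on $R$. **Theorem (Decomposition).** Consider a three-dimensional STS model at the system size $n_2=2^m$, $n_1=2\cdot\left(2^{2n_2v}\right)!$ and arbitrary $n_3\ge 1$, where $m$ is an arbitrary positive integer. For every logical operator $\ell$ supported on $P(n_1,n_2,1)$ there are $\ell_a,\ell_b\in\mathcal C_{P(n_1,n_2,1)}$ such that $$\ell\sim\ell_a\ell_b,$$ $\ell_a$ is supported on $P(2v,n_2,1)$, and $T_1^{\beta}(\ell_b)=\ell_b$ for some integer $\beta$ with $1\le\beta\le 2^{2n_2v}$. -/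

import Mathlib

namespace STS

/-- The exponent of `i` in `Z^a X^b = (-1)^(a b) X^b Z^a`. -/
def signExp (a b : ZMod 2) : ZMod 4 := ((2 * (a.val * b.val) : ℕ) : ZMod 4)

theorem signExp_add_left (a a' b : ZMod 2) :
    signExp (a + a') b = signExp a b + signExp a' b := by
  revert a a' b; decide

theorem signExp_add_right (a b b' : ZMod 2) :
    signExp a (b + b') = signExp a b + signExp a b' := by
  revert a b b'; decide

theorem signExp_add_self (a b : ZMod 2) : signExp a b + signExp a b = 0 := by
  revert a b; decide

/-- The Pauli group `⟨i I, X_q, Z_q : q ∈ Q⟩` on the set of qubits `Q`. The element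
`⟨p, x, z⟩` is the operator `i^p (∏_q X_q^(x q)) (∏_q Z_q^(z q))`; every element of the Pauli group
has exactly one such expression. -/
@[ext]
structure Pauli (Q : Type) where
  phase : ZMod 4
  x : Q → ZMod 2
  z : Q → ZMod 2

namespace Pauli

variable {Q : Type}

instance [Finite Q] : Finite (Pauli Q) :=
  Finite.of_injective (β := ZMod 4 × (Q → ZMod 2) × (Q → ZMod 2))
    (fun U => (U.phase, U.x, U.z)) (by
      intro U W h
      simp only [Prod.mk.injEq] at h
      exact Pauli.ext h.1 h.2.1 h.2.2)

/-- Multiplication of operators: moving `∏ Z_q^(z q)` past `∏ X_q^(x' q)` gives the sign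
`(-1)^(∑ z q x' q)`. -/
instance [Fintype Q] : Mul (Pauli Q) :=
  ⟨fun U W => ⟨U.phase + W.phase + ∑ q, signExp (U.z q) (W.x q), U.x + W.x, U.z + W.z⟩⟩

instance : One (Pauli Q) := ⟨⟨0, 0, 0⟩⟩

instance [Fintype Q] : Inv (Pauli Q) :=
  ⟨fun U => ⟨-U.phase + ∑ q, signExp (U.z q) (U.x q), U.x, U.z⟩⟩

theorem mul_def [Fintype Q] (U W : Pauli Q) :
    U * W = ⟨U.phase + W.phase + ∑ q, signExp (U.z q) (W.x q), U.x + W.x, U.z + W.z⟩ := rfl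

theorem one_def : (1 : Pauli Q) = ⟨0, 0, 0⟩ := rfl

theorem inv_def [Fintype Q] (U : Pauli Q) :
    U⁻¹ = ⟨-U.phase + ∑ q, signExp (U.z q) (U.x q), U.x, U.z⟩ := rfl

instance [Fintype Q] : Group (Pauli Q) :=
  Group.ofLeftAxioms
    (by
      intro a b c
      simp only [mul_def]
      ext
      · simp only [Pi.add_apply, signExp_add_left, signExp_add_right, Finset.sum_add_distrib]
        ring
      · simp [add_assoc]
      · simp [add_assoc])
    (by
      intro a
      simp only [mul_def, one_def]
      ext <;> simp [signExp])
    (by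
      intro a
      simp only [mul_def, inv_def, one_def]
      ext q
      · have h : ∑ q, signExp (a.z q) (a.x q) + ∑ q, signExp (a.z q) (a.x q) = 0 := by
          simp [← Finset.sum_add_distrib, signExp_add_self]
        linear_combination h
      · exact CharTwo.add_self_eq_zero _
      · exact CharTwo.add_self_eq_zero _)

/-- The scalar operator `i^p I`. -/
def scalar (p : ZMod 4) : Pauli Q := ⟨p, 0, 0⟩

end Pauli

/-- The composite particles of the periodic `n 0 × n 1 × n 2` lattice. The coordinates are numbered
from `0`: the particle `P_{r₁,r₂,r₃}` is the site `(r₁ - 1, r₂ - 1, r₃ - 1)`. -/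
abbrev Site (n : Fin 3 → ℕ+) : Type := (m : Fin 3) → ZMod (n m : ℕ)

/-- The qubits of the system of size `n`, with `v` qubits in each composite particle. -/
abbrev Qubit (v : ℕ) (n : Fin 3 → ℕ+) : Type := Site n × Fin v

/-- The `2 × 2 × 2` composite particles on which an interaction term lives. -/
abbrev Corner : Type := Fin 3 → Fin 2

/-- The corners in lexicographic order. -/
def corners : List Corner :=
  [![0, 0, 0], ![0, 0, 1], ![0, 1, 0], ![0, 1, 1],
   ![1, 0, 0], ![1, 0, 1], ![1, 1, 0], ![1, 1, 1]]

section Lattice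

variable {v : ℕ} {n : Fin 3 → ℕ+}

/-- The operator `∏_q X_q^(a q) ∏_q Z_q^(b q)` on the `v` qubits of the composite particle `s`. -/
def atSite (s : Site n) (a b : Fin v → ZMod 2) : Pauli (Qubit v n) :=
  ⟨0, fun q => if q.1 = s then a q.2 else 0, fun q => if q.1 = s then b q.2 else 0⟩

/-- The interaction term `g` on `2 × 2 × 2` composite particles, placed on the torus with its
corner `(0,0,0)` at `r`. If all `n m ≥ 2`, the eight factors act on different particles and
their order is irrelevant; if some `n m = 1`, the term is wrapped around the torus. -/
def place (n : Fin 3 → ℕ+) (g : Pauli (Corner × Fin v)) (r : Site n) : Pauli (Qubit v n) :=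
  Pauli.scalar g.phase *
    (corners.map fun c =>
      atSite (r + fun m => ((c m : ℕ) : ZMod (n m : ℕ)))
        (fun q => g.x (c, q)) (fun q => g.z (c, q))).prod

/-- The stabilizer group of the system of size `n`: it is generated by all translates of the
interaction terms. -/
def stabilizer (terms : Set (Pauli (Corner × Fin v))) (n : Fin 3 → ℕ+) :
    Subgroup (Pauli (Qubit v n)) :=
  Subgroup.closure {U | ∃ g ∈ terms, ∃ r : Site n, U = place n g r}

/-- The unit translation `T_m` of composite particles in direction `m`. -/
def translate (m : Fin 3) (U : Pauli (Qubit v n)) : Pauli (Qubit v n) :=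
  ⟨U.phase, fun q => U.x (q.1 - Pi.single m 1, q.2), fun q => U.z (q.1 - Pi.single m 1, q.2)⟩

/-- The region `P(x₁, x₂, x₃)` of composite particles. -/
def region (n : Fin 3 → ℕ+) (x₁ x₂ x₃ : ℕ) : Set (Site n) :=
  {r | (r 0).val < x₁ ∧ (r 1).val < x₂ ∧ (r 2).val < x₃}

/-- `U` acts trivially on all composite particles outside `R`. -/
def SupportedOn (U : Pauli (Qubit v n)) (R : Set (Site n)) : Prop :=
  ∀ q : Qubit v n, q.1 ∉ R → U.x q = 0 ∧ U.z q = 0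

end Lattice

/-- A three-dimensional stabilizer code with translation and scale symmetries, with `v` qubits per
composite particle. The same local interaction terms define a stabilizer code on every
`n 0 × n 1 × n 2` torus into which a `2 × 2 × 2` region fits, and the number `N - G(𝒮)` of logical
qubits is the same number `k` for all these sizes. (`G(𝒮)` is the minimal number of generators.) -/
structure Model (v : ℕ) where
  terms : Set (Pauli (Corner × Fin v))
  k : ℕ
  commute : ∀ n : Fin 3 → ℕ+, (∀ m, 2 ≤ (n m : ℕ)) →
    ∀ U ∈ stabilizer terms n, ∀ W ∈ stabilizer terms n, U * W = W * U
  neg_one_notMem : ∀ n : Fin 3 → ℕ+, (∀ m, 2 ≤ (n m : ℕ)) →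
    Pauli.scalar 2 ∉ stabilizer terms n
  scale : ∀ n : Fin 3 → ℕ+, (∀ m, 2 ≤ (n m : ℕ)) →
    Group.rank (stabilizer terms n) + k = v * ((n 0 : ℕ) * n 1 * n 2)

namespace Model

variable {v : ℕ}

/-- The stabilizer group `𝒮` of the model at size `n`. -/
def stab (M : Model v) (n : Fin 3 → ℕ+) : Subgroup (Pauli (Qubit v n)) :=
  stabilizer M.terms n

/-- The group `𝒞` of Pauli operators which commute with all stabilizers. -/
def centralizer (M : Model v) (n : Fin 3 → ℕ+) : Subgroup (Pauli (Qubit v n)) :=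
  Subgroup.centralizer (M.stab n : Set (Pauli (Qubit v n)))

/-- The set `𝒞_R` of centralizer operators supported on `R`. -/
def centralizerOn (M : Model v) (n : Fin 3 → ℕ+) (R : Set (Site n)) :
    Set (Pauli (Qubit v n)) :=
  {U | U ∈ M.centralizer n ∧ SupportedOn U R}

/-- The set of logical operators. -/
def logical (M : Model v) (n : Fin 3 → ℕ+) : Set (Pauli (Qubit v n)) :=
  {U | U ∈ M.centralizer n ∧ U ^ 2 = 1 ∧ U ∉ M.stab n}

/-- Equivalence `U ∼ W` of operators; `U⁻¹ = U` if `U` is a logical operator. -/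
def Equivalent (M : Model v) (n : Fin 3 → ℕ+) (U W : Pauli (Qubit v n)) : Prop :=
  U⁻¹ * W ∈ M.stab n

end Model

end STS

/-!
The proof works with Pauli operators up to phase, that is, with configurations over `ZMod 2` on the
torus; commutation is the vanishing of a symplectic form, the stabilizers form a subspace `S` and
the centralizer is its orthogonal complement `C`. Write `T` for the unit translation in the first
direction. The decomposition rests on three facts.

*Translations act trivially on logical operators*: `(T - 1) C ≤ S` (`shift_one_sub_mem`). For a
torus of length `N` covering one of length `d`, folding maps `S_N` onto `S_d`. A stabilizer of the
long torus which folds to zero always lies in `(T ^ d - 1) C_N`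
(`exists_orthogonal_shift_sub_eq`), so by counting dimensions `(T ^ d - 1) C_N ≤ S_N` holds exactly
if both tori have the same number of logical qubits (`shift_sub_mem_iff`). Scale symmetry gives this
for `N = 6` and `d = 2, 3`. Hence `T - 1` maps `C_6` into `S_6`, so the torus of length one has `k`
logical qubits as well, and the criterion with `d = 1` applies to every length `N ≥ 2`.

*Finite walks are generated by short ones* (`finiteWalk_le_shorterWalk`). An operator on a plane
commutes with the stabilizers exactly if any two neighbouring columns satisfy a certain linear
relation, so that it is a closed walk of this relation. Translation of columns in the second
direction is a symmetry of the relation, and as the width is a power of two, its difference `u` with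
the identity is nilpotent; the kernel of `u` consists of constant columns and has dimension at most
`2 v`. Among more than `2 v` positions of a finite walk there is a linear dependency modulo the
image of `u`. Moving the walk so that these positions coincide gives a walk with a zero, and cutting
there exhibits the original walk as a sum of shorter ones modulo `u`, hence, by nilpotency,
outright.

*Pigeonhole* (`exists_periodic_walk`). A plane operator has two equal columns among its first
`2 ^ (2 n₂ v) + 1` ones. The stretch between them closes up to a periodic operator, since the period
divides `n₁`.

Subtracting the periodic operator leaves a finite walk, which is a walk of length `2 v` up to a
difference `T b - b`, and this difference is a stabilizer. The phase that was neglected is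
absorbed into the first factor.
-/

/-! ### Pushing forward, pulling back and shifting configurations -/

namespace STS

section Configurations

variable {K E A B : Type*} [Field K] [AddCommGroup E] [Module K E]

/-- The sum of a configuration `p` over the fibres of `φ`: folding a torus onto a smaller one. -/
def push [Fintype A] [DecidableEq B] (K : Type*) {E : Type*} [Field K] [AddCommGroup E] [Module K E]
    (φ : A → B) : (A → E) →ₗ[K] (B → E) where
  toFun p b := ∑ a with φ a = b, p a
  map_add' p q := by ext b; simp [Finset.sum_add_distrib]
  map_smul' c p := by ext b; simp [Finset.smul_sum]

theorem push_apply [Fintype A] [DecidableEq B] (φ : A → B) (p : A → E) (b : B) :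
    push K φ p b = ∑ a with φ a = b, p a := rfl

theorem push_single [Fintype A] [DecidableEq A] [DecidableEq B] (φ : A → B) (a : A) (e : E) :
    push K φ (Pi.single a e) = Pi.single (φ a) e := by
  ext b
  rw [push_apply, Finset.sum_filter, Finset.sum_eq_single a]
  · by_cases h : φ a = b
    · subst h; simp
    · simp [h, Ne.symm h]
  · intro a' _ h
    simp [h]
  · simp

/-- The configuration on the source of `φ` which repeats a configuration on its target: unfolding
a torus to a larger one. -/
def pull (K : Type*) {E : Type*} [Field K] [AddCommGroup E] [Module K E] (φ : A → B) :
    (B → E) →ₗ[K] (A → E) :=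
  LinearMap.funLeft K E φ

@[simp]
theorem pull_apply (φ : A → B) (p : B → E) (a : A) : pull K φ p a = p (φ a) := rfl

theorem pull_injective {φ : A → B} (hφ : Function.Surjective φ) :
    Function.Injective (pull K φ : (B → E) →ₗ[K] (A → E)) :=
  LinearMap.funLeft_injective_of_surjective K E φ hφ

theorem push_surjective [Fintype A] [DecidableEq A] [Fintype B] [DecidableEq B] {φ : A → B}
    (hφ : Function.Surjective φ) : Function.Surjective (push K φ : (A → E) →ₗ[K] (B → E)) := by
  intro q
  refine ⟨∑ b, Pi.single (Function.surjInv hφ b) (q b), ?_⟩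
  simp only [map_sum, push_single, Function.surjInv_eq]
  exact Finset.univ_sum_single q

theorem push_push {C : Type*} [Fintype A] [DecidableEq A] [Fintype B] [DecidableEq B]
    [DecidableEq C] (φ : A → B) (ψ : B → C) (p : A → E) :
    push K ψ (push K φ p) = push K (ψ ∘ φ) p := by
  rw [← Finset.univ_sum_single p]
  simp only [map_sum, push_single, Function.comp_apply]

/-- The translation of a configuration by `t`. -/
def shift [AddCommGroup A] (K : Type*) {E : Type*} [Field K] [AddCommGroup E] [Module K E] (t : A) :
    (A → E) →ₗ[K] (A → E) :=
  LinearMap.funLeft K E fun a => a - t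

@[simp]
theorem shift_apply [AddCommGroup A] (t : A) (p : A → E) (a : A) : shift K t p a = p (a - t) := rfl

theorem shift_zero [AddCommGroup A] (p : A → E) : shift K 0 p = p := by ext; simp

theorem shift_shift [AddCommGroup A] (s t : A) (p : A → E) :
    shift K s (shift K t p) = shift K (s + t) p := by
  ext a; simp [sub_sub]

theorem shift_single [AddCommGroup A] [DecidableEq A] (t a : A) (e : E) :
    shift K t (Pi.single a e) = Pi.single (a + t) e := by
  ext b
  simp [Pi.single_apply, sub_eq_iff_eq_add]

theorem push_shift [AddCommGroup A] [Fintype A] [DecidableEq A] [AddCommGroup B] [DecidableEq B]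
    (φ : A →+ B) (t : A) (p : A → E) :
    push K φ (shift K t p) = shift K (φ t) (push K φ p) := by
  rw [← Finset.univ_sum_single p]
  simp only [map_sum, push_single, shift_single, map_add]

theorem shift_pull [AddCommGroup A] [AddCommGroup B] (φ : A →+ B) (t : A) (p : B → E) :
    shift K t (pull K φ p) = pull K φ (shift K (φ t) p) := by
  ext a; simp

/-- If a space of configurations is invariant under shifts, then being fixed modulo this space by a
shift passes to the multiples of the shift. -/
theorem shift_nsmul_sub_mem [AddCommGroup A] {S : Submodule K (A → E)}
    (hS : ∀ t, ∀ p ∈ S, shift K t p ∈ S) {t : A} {p : A → E} (h : shift K t p - p ∈ S) (k : ℕ) :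
    shift K (k • t) p - p ∈ S := by
  induction k with
  | zero => simp [shift_zero]
  | succ k ih =>
    have := S.add_mem (hS (k • t) _ h) ih
    rwa [map_sub, shift_shift, ← succ_nsmul, sub_add_sub_cancel] at this

/-- A configuration fixed by the shift by `t` is repeated from a quotient by the multiples of
`t`. -/
theorem exists_pull_eq [AddCommGroup A] [AddCommGroup B] {φ : A →+ B}
    (hφ : Function.Surjective φ) {t : A} (hker : ∀ a, φ a = 0 → ∃ k : ℕ, a = k • t) {p : A → E}
    (hp : shift K t p = p) : ∃ q, pull K φ q = p := by
  have hk : ∀ (k : ℕ) (a : A), p (a - k • t) = p a := by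
    intro k
    induction k with
    | zero => simp
    | succ k ih =>
      intro a
      rw [succ_nsmul, ← sub_sub, ← ih a]
      exact congrFun hp (a - k • t)
  refine ⟨fun b => p (Function.surjInv hφ b), ?_⟩
  ext a
  simp only [pull_apply]
  obtain ⟨k, h⟩ := hker (a - Function.surjInv hφ (φ a)) (by
    rw [map_sub, Function.surjInv_eq hφ, sub_self])
  rw [← hk k a, ← h, sub_sub_cancel]

theorem finrank_map_add_finrank_inf_ker {V W : Type*} [AddCommGroup V] [Module K V]
    [FiniteDimensional K V] [AddCommGroup W] [Module K W] (f : V →ₗ[K] W) (S : Submodule K V) :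
    Module.finrank K (S.map f) + Module.finrank K (S ⊓ LinearMap.ker f : Submodule K V) =
      Module.finrank K S := by
  have h := LinearMap.finrank_range_add_finrank_ker (f.domRestrict S)
  rw [LinearMap.range_domRestrict, LinearMap.ker_domRestrict] at h
  rw [← h, ← Submodule.map_comap_subtype, Submodule.finrank_map_subtype_eq]

/-- A configuration whose sums over the fibres vanish is a difference of shifts. -/
theorem exists_shift_sub_eq [AddCommGroup A] [Fintype A] [DecidableEq A] [AddCommGroup B]
    [Fintype B] [DecidableEq B] [FiniteDimensional K E] {φ : A →+ B} (hφ : Function.Surjective φ)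
    {t : A} (hker : ∀ a, φ a = 0 → ∃ k : ℕ, a = k • t) (ht : φ t = 0) {p : A → E}
    (hp : push K φ p = 0) : ∃ q, shift K t q - q = p := by
  have hle : LinearMap.range (shift K t - LinearMap.id : (A → E) →ₗ[K] (A → E)) ≤
      LinearMap.ker (push K φ) := by
    rintro _ ⟨q, rfl⟩
    simp [push_shift, ht, shift_zero]
  have hk : LinearMap.ker (shift K t - LinearMap.id : (A → E) →ₗ[K] (A → E)) ≤
      LinearMap.range (pull K φ : (B → E) →ₗ[K] (A → E)) := by
    intro q hq
    exact exists_pull_eq hφ hker (sub_eq_zero.1 hq)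
  have h1 := LinearMap.finrank_range_add_finrank_ker
    (shift K t - LinearMap.id : (A → E) →ₗ[K] (A → E))
  have h2 := LinearMap.finrank_range_add_finrank_ker (push K φ : (A → E) →ₗ[K] (B → E))
  rw [LinearMap.range_eq_top.2 (push_surjective hφ), finrank_top] at h2
  have h3 := Submodule.finrank_mono hk
  rw [LinearMap.finrank_range_of_inj (pull_injective hφ)] at h3
  have h4 := Submodule.finrank_mono hle
  have h5 := Submodule.eq_of_le_of_finrank_eq hle (by omega)
  have h6 : p ∈ LinearMap.ker (push K φ : (A → E) →ₗ[K] (B → E)) := hp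
  rw [← h5] at h6
  obtain ⟨q, hq⟩ := h6
  exact ⟨q, hq⟩

/-- The bilinear form on configurations which sums the values of `ω` over all sites. -/
def latticeForm (A : Type*) [Fintype A] (ω : LinearMap.BilinForm K E) :
    LinearMap.BilinForm K (A → E) :=
  LinearMap.mk₂ K (fun p q => ∑ a, ω (p a) (q a))
    (by intros; simp [Finset.sum_add_distrib]) (by intros; simp [Finset.mul_sum])
    (by intros; simp [Finset.sum_add_distrib]) (by intros; simp [Finset.mul_sum])

variable {ω : LinearMap.BilinForm K E}

theorem latticeForm_apply [Fintype A] (p q : A → E) :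
    latticeForm A ω p q = ∑ a, ω (p a) (q a) := rfl

theorem latticeForm_single_left [Fintype A] [DecidableEq A] (a : A) (e : E) (q : A → E) :
    latticeForm A ω (Pi.single a e) q = ω e (q a) := by
  rw [latticeForm_apply, Finset.sum_eq_single a]
  · simp
  · intro b _ hb; simp [hb]
  · simp

theorem latticeForm_comm [Fintype A] (hω : ∀ a b, ω a b = ω b a) (p q : A → E) :
    latticeForm A ω p q = latticeForm A ω q p := by
  simp only [latticeForm_apply]
  exact Finset.sum_congr rfl fun a _ => hω _ _

theorem latticeForm_nondegenerate [Fintype A] [DecidableEq A] (hω : ∀ a b, ω a b = ω b a)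
    (hnd : ∀ a, (∀ b, ω b a = 0) → a = 0) : (latticeForm A ω).Nondegenerate := by
  have h : ∀ q : A → E, (∀ p, latticeForm A ω p q = 0) → q = 0 := by
    intro q hq
    ext a
    refine hnd _ fun b => ?_
    rw [← latticeForm_single_left, hq]
  exact ⟨fun q hq => h q fun p => by rw [latticeForm_comm hω, hq], h⟩

theorem latticeForm_push_left [Fintype A] [Fintype B] [DecidableEq B] (φ : A → B) (p : A → E)
    (q : B → E) : latticeForm B ω (push K φ p) q = latticeForm A ω p (pull K φ q) := by
  simp only [latticeForm_apply, push_apply, map_sum, LinearMap.sum_apply, pull_apply]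
  rw [← Finset.sum_fiberwise (s := Finset.univ) (g := φ)]
  refine Finset.sum_congr rfl fun b _ => Finset.sum_congr rfl fun a ha => ?_
  rw [(Finset.mem_filter.1 ha).2]

theorem latticeForm_shift_left [AddCommGroup A] [Fintype A] (t : A) (p q : A → E) :
    latticeForm A ω (shift K t p) q = latticeForm A ω p (shift K (-t) q) := by
  simp only [latticeForm_apply, shift_apply]
  exact Fintype.sum_equiv (Equiv.subRight t) _ _ (by intro a; simp)

end Configurations

/-! ### When a translation acts trivially on logical operators -/

section Translation

variable {E A' A B : Type*} [AddCommGroup E] [Module (ZMod 2) E]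
  [AddCommGroup A'] [Fintype A'] [DecidableEq A'] [AddCommGroup A] [DecidableEq A]
  [AddCommGroup B] [Fintype B] [DecidableEq B]
  {ω : LinearMap.BilinForm (ZMod 2) E}

theorem pull_push_eq_shift_add {φ : A' →+ A} {w : A'} (hw : w ≠ 0)
    (hφ : ∀ a, φ a = 0 ↔ a = 0 ∨ a = w) (p : A' → E) :
    pull (ZMod 2) φ (push (ZMod 2) φ p) = p + shift (ZMod 2) (-w) p := by
  ext a
  have : (Finset.univ.filter fun b => φ b = φ a) = {a, a + w} := by
    ext b
    have := hφ (b - a)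
    rw [map_sub, sub_eq_zero, sub_eq_zero, sub_eq_iff_eq_add'] at this
    simpa using this
  simp only [pull_apply, push_apply, this, Pi.add_apply, shift_apply, sub_neg_eq_add]
  rw [Finset.sum_pair]
  simpa using hw

variable [Fintype A]

/-- A stabilizer of a torus which folds to zero is a difference of translates of an operator which
commutes with all stabilizers. To see it, lift the stabilizer to the double torus: there it is
`T p' - p'`, and `p'` folds to the desired operator, because unfolding after folding is `1 + T ^ N`
and the stabilizers of the double torus commute with each other. -/
theorem exists_orthogonal_shift_sub_eq [FiniteDimensional (ZMod 2) E] {φ' : A' →+ A} {φ : A →+ B}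
    (hφ' : Function.Surjective φ') (hφ : Function.Surjective φ)
    {t' w : A'} (hw : w ≠ 0) (hker' : ∀ a, φ' a = 0 ↔ a = 0 ∨ a = w)
    (hkert : ∀ a, φ (φ' a) = 0 → ∃ k : ℕ, a = k • t') (ht : φ (φ' t') = 0)
    {S' : Submodule (ZMod 2) (A' → E)} {S : Submodule (ZMod 2) (A → E)}
    (hS : S'.map (push (ZMod 2) φ') = S) (hshift : ∀ t, ∀ p ∈ S', shift (ZMod 2) t p ∈ S')
    (hiso : ∀ p ∈ S', ∀ q ∈ S', latticeForm A' ω p q = 0)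
    {s : A → E} (hs : s ∈ S) (hs0 : push (ZMod 2) φ s = 0) :
    ∃ p ∈ (latticeForm A ω).orthogonal S, shift (ZMod 2) (φ' t') p - p = s := by
  subst hS
  obtain ⟨s', hs', rfl⟩ := hs
  rw [push_push] at hs0
  obtain ⟨p', hp'⟩ := exists_shift_sub_eq (φ := φ.comp φ') (hφ.comp hφ') (t := t') hkert ht hs0
  refine ⟨push (ZMod 2) φ' p', ?_, ?_⟩
  · rintro _ ⟨q', hq', rfl⟩
    obtain ⟨k, hk⟩ := hkert w (by rw [(hker' w).2 (Or.inr rfl), map_zero])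
    have hww : -w = w := by
      have h := (hker' (-w)).1 (by rw [map_neg, (hker' w).2 (Or.inr rfl), neg_zero])
      exact h.resolve_left (by simpa using hw)
    have hmem : p' + shift (ZMod 2) (-w) p' ∈ S' := by
      have h := shift_nsmul_sub_mem hshift (t := t') (p := p') (by rw [hp']; exact hs') k
      rw [← hk] at h
      have h2 : p' + shift (ZMod 2) (-w) p' = shift (ZMod 2) w p' - p' := by
        rw [hww, ZModModule.sub_eq_add, add_comm]
      rwa [h2]
    rw [latticeForm_push_left, pull_push_eq_shift_add hw hker']
    exact hiso _ hq' _ hmem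
  · rw [← push_shift, ← map_sub, hp']

/-- Translation by a period of a smaller torus acts trivially on the logical operators exactly if
the two tori have the same number of logical qubits. The dimensions of `S ⊓ ker (push φ)` and of
the image of the orthogonal complement of `S` under `T - 1`, which contains it, differ by the
difference of these numbers. -/
theorem shift_sub_mem_iff [FiniteDimensional (ZMod 2) E] (hω : ∀ a b, ω a b = ω b a)
    (hnd : ∀ a, (∀ b, ω b a = 0) → a = 0) {φ' : A' →+ A} {φ : A →+ B}
    (hφ' : Function.Surjective φ') (hφ : Function.Surjective φ)
    {t' w : A'} (hw : w ≠ 0) (hker' : ∀ a, φ' a = 0 ↔ a = 0 ∨ a = w)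
    (hkert : ∀ a, φ (φ' a) = 0 → ∃ k : ℕ, a = k • t')
    (hker : ∀ a, φ a = 0 → ∃ k : ℕ, a = k • φ' t') (ht : φ (φ' t') = 0)
    {S' : Submodule (ZMod 2) (A' → E)} {S : Submodule (ZMod 2) (A → E)}
    {Q : Submodule (ZMod 2) (B → E)}
    (hS : S'.map (push (ZMod 2) φ') = S) (hQ : S.map (push (ZMod 2) φ) = Q)
    (hshift : ∀ t, ∀ p ∈ S', shift (ZMod 2) t p ∈ S')
    (hiso : ∀ p ∈ S', ∀ q ∈ S', latticeForm A' ω p q = 0) :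
    (∀ c ∈ (latticeForm A ω).orthogonal S, shift (ZMod 2) (φ' t') c - c ∈ S) ↔
      2 * Module.finrank (ZMod 2) S + Module.finrank (ZMod 2) (B → E) =
        Module.finrank (ZMod 2) (A → E) + 2 * Module.finrank (ZMod 2) Q := by
  set C := (latticeForm A ω).orthogonal S with hC
  let D : (A → E) →ₗ[ZMod 2] (A → E) := shift (ZMod 2) (φ' t') - LinearMap.id
  have hD : ∀ c, D c = shift (ZMod 2) (φ' t') c - c := fun c => rfl
  have hle : S ⊓ LinearMap.ker (push (ZMod 2) φ) ≤ C.map D := by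
    rintro s ⟨hs, hs0⟩
    obtain ⟨p, hp, h⟩ :=
      exists_orthogonal_shift_sub_eq hφ' hφ hw hker' hkert ht hS hshift hiso hs hs0
    exact ⟨p, hp, h⟩
  have hkerC : C ⊓ LinearMap.ker D =
      ((latticeForm B ω).orthogonal Q).map (pull (ZMod 2) φ) := by
    ext c
    constructor
    · rintro ⟨hc, hc0⟩
      obtain ⟨q, rfl⟩ := exists_pull_eq (K := ZMod 2) hφ hker (p := c) (sub_eq_zero.1 hc0)
      refine ⟨q, ?_, rfl⟩
      rw [← hQ]
      rintro _ ⟨s, hs, rfl⟩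
      rw [latticeForm_push_left]
      exact hc s hs
    · rintro ⟨q, hq, rfl⟩
      refine ⟨fun s hs => ?_, ?_⟩
      · rw [← latticeForm_push_left]
        exact hq _ (hQ ▸ Submodule.mem_map_of_mem hs)
      · change D _ = 0
        rw [hD, shift_pull, ht, shift_zero, sub_self]
  have h1 := finrank_map_add_finrank_inf_ker (push (ZMod 2) φ) S
  have h2 := finrank_map_add_finrank_inf_ker D C
  rw [hQ] at h1
  rw [hkerC, ← (Submodule.equivMapOfInjective _ (pull_injective hφ) _).finrank_eq,
    LinearMap.BilinForm.finrank_orthogonal (latticeForm_nondegenerate hω hnd), hC,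
    LinearMap.BilinForm.finrank_orthogonal (latticeForm_nondegenerate hω hnd), ← hC] at h2
  have h3 := Submodule.finrank_le S
  have h4 := Submodule.finrank_le Q
  constructor
  · intro h
    have : C.map D = S ⊓ LinearMap.ker (push (ZMod 2) φ) := by
      refine le_antisymm ?_ hle
      rintro _ ⟨c, hc, rfl⟩
      refine ⟨h c hc, ?_⟩
      change push (ZMod 2) φ (D c) = 0
      rw [hD, map_sub, push_shift, ht, shift_zero, sub_self]
    rw [this] at h2
    omega
  · intro h c hc
    have := Submodule.eq_of_le_of_finrank_eq hle (by omega)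
    have h5 : D c ∈ C.map D := ⟨c, hc, rfl⟩
    rw [← this] at h5
    exact h5.1

end Translation

end STS

/-! ### Finite walks of a linear relation -/

namespace STS

section Walks

variable {K W : Type*} [Field K] [AddCommGroup W] [Module K W] {R : Submodule K (W × W)}

/-- The bi-infinite sequences whose consecutive terms are related by the linear relation `R` and
which vanish outside `[0, d)`. -/
def finiteWalk (R : Submodule K (W × W)) (d : ℕ) : Submodule K (ℤ → W) where
  carrier := {x | (∀ j, (x j, x (j + 1)) ∈ R) ∧ ∀ j, j < 0 ∨ (d : ℤ) ≤ j → x j = 0}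
  zero_mem' := ⟨fun _ => R.zero_mem, fun _ _ => rfl⟩
  add_mem' := fun hx hy => ⟨fun j => R.add_mem (hx.1 j) (hy.1 j), fun j hj => by
    simp [hx.2 j hj, hy.2 j hj]⟩
  smul_mem' := fun c x hx => ⟨fun j => R.smul_mem c (hx.1 j), fun j hj => by simp [hx.2 j hj]⟩

theorem finiteWalk_mono {d e : ℕ} (h : d ≤ e) : finiteWalk R d ≤ finiteWalk R e :=
  fun _ hx => ⟨hx.1, fun j hj => hx.2 j (by omega)⟩

/-- The walks in `[0, d + 1)` which are sums of walks in `[0, d)` and in `[1, d + 1)`. -/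
def shorterWalk (R : Submodule K (W × W)) (d : ℕ) : Submodule K (ℤ → W) :=
  finiteWalk R d ⊔ (finiteWalk R d).map (shift K 1)

theorem mem_shorterWalk_of_apply_eq {d : ℕ} {x y : ℤ → W} (hx : x ∈ finiteWalk R (d + 1))
    (hy : y ∈ finiteWalk R d) (h : x 0 = y 0) : ∃ b ∈ finiteWalk R d, x = y + shift K 1 b := by
  have hxy := (finiteWalk R (d + 1)).sub_mem hx (finiteWalk_mono (Nat.le_succ d) hy)
  refine ⟨shift K (-1) (x - y), ⟨fun j => ?_, fun j hj => ?_⟩, ?_⟩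
  · have := hxy.1 (j + 1)
    simpa [sub_neg_eq_add] using this
  · rw [shift_apply, sub_neg_eq_add]
    rcases lt_trichotomy j (-1) with h1 | h1 | h1
    · exact hxy.2 _ (by omega)
    · subst h1; simp [h]
    · exact hxy.2 _ (by push_cast; omega)
  · rw [shift_shift]; simp [shift_zero]

/-- The part of a walk before a zero is a walk. The walk is read from position `-i` on. -/
theorem exists_finiteWalk_of_apply_eq_zero {z : ℤ → W} (hz : ∀ j, (z j, z (j + 1)) ∈ R) {i : ℕ}
    (hzi : ∀ j < -(i : ℤ), z j = 0) (h0 : z 0 = 0) :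
    ∃ y ∈ finiteWalk R i, ∀ j < (i : ℤ), y j = z (j - i) := by
  refine ⟨fun j => if j < i then z (j - i) else 0, ⟨fun j => ?_, fun j hj => ?_⟩, ?_⟩
  · have h := hz (j - i)
    rw [show j - i + 1 = j + 1 - (i : ℤ) by ring] at h
    dsimp only
    rcases lt_trichotomy (j + 1) (i : ℤ) with h1 | h1 | h1
    · rw [if_pos (by omega), if_pos h1]; exact h
    · rw [if_pos (by omega), if_neg (by omega)]
      rwa [h1, sub_self, h0] at h
    · rw [if_neg (by omega), if_neg (by omega)]; exact R.zero_mem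
  · dsimp only
    rcases hj with hj | hj
    · rw [if_pos (by omega), hzi _ (by omega)]
    · rw [if_neg (by omega)]
  · intro j hj
    exact if_pos hj

/-- If walks of length `d + 1`, read at the distinct positions `0, …, d`, sum to zero, then each of
them is a sum of walks of length `d`. The walks, moved so that these positions coincide, sum to a
walk with a zero; the part of it before the zero starts like the walk that was moved furthest, and
so splits off a shorter one from it. -/
theorem mem_shorterWalk_of_sum_eq_zero {d : ℕ} : ∀ (n : ℕ), n ≤ d + 1 → ∀ y : ℕ → ℤ → W,
    (∀ i, y i ∈ finiteWalk R (d + 1)) → ∑ i ∈ Finset.range n, y i i = 0 →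
    ∀ i < n, y i ∈ shorterWalk R d := by
  intro n
  induction n with
  | zero => intro _ _ _ _ i hi; omega
  | succ n ih =>
    intro hn y hy hsum
    let z : ℤ → W := ∑ i ∈ Finset.range (n + 1), shift K (-(i : ℤ)) (y i)
    have hz_apply : ∀ j, z j = ∑ i ∈ Finset.range (n + 1), y i (j + i) := by
      intro j
      simp [z, Finset.sum_apply]
    have hz : ∀ j, (z j, z (j + 1)) ∈ R := by
      intro j
      have : (z j, z (j + 1)) = ∑ i ∈ Finset.range (n + 1), (y i (j + i), y i (j + i + 1)) := by
        refine Prod.ext ?_ ?_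
        · rw [Prod.fst_sum, hz_apply]
        · have h (i : ℕ) : j + 1 + (i : ℤ) = j + i + 1 := add_right_comm _ _ _
          simp only [Prod.snd_sum, hz_apply (j + 1), h]
      rw [this]
      exact R.sum_mem fun i _ => (hy i).1 _
    obtain ⟨a, ha, haz⟩ := exists_finiteWalk_of_apply_eq_zero hz (i := n)
      (by
        intro j hj
        rw [hz_apply]
        refine Finset.sum_eq_zero fun i hi => (hy i).2 _ (Or.inl ?_)
        have := Finset.mem_range.1 hi
        omega)
      (by simpa [hz_apply] using hsum)
    -- at the first position only the walk that was moved furthest is nonzero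
    have hstart : a 0 = y n 0 := by
      rcases Nat.eq_zero_or_pos n with h | h
      · subst h
        rw [ha.2 0 (Or.inr (by simp))]
        simpa using hsum.symm
      · rw [haz 0 (by omega), hz_apply, Finset.sum_eq_single n]
        · simp
        · intro i hi hin
          have := Finset.mem_range.1 hi
          exact (hy i).2 _ (Or.inl (by omega))
        · simp
    obtain ⟨b, hb, hyab⟩ := mem_shorterWalk_of_apply_eq (hy n)
      (finiteWalk_mono (by omega) ha) hstart.symm
    have hyn : y n ∈ shorterWalk R d := by
      rw [hyab]
      exact Submodule.add_mem_sup (finiteWalk_mono (by omega) ha) (Submodule.mem_map_of_mem hb)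
    rcases Nat.eq_zero_or_pos n with h | h
    · subst h
      intro i hi
      obtain rfl : i = 0 := by omega
      exact hyn
    obtain ⟨n, rfl⟩ : ∃ n', n = n' + 1 := ⟨n - 1, by omega⟩
    -- the rest of the walk is absorbed into the next one
    have key := ih (by omega) (Function.update y n (y n + b))
      (by
        intro i
        by_cases hi : i = n
        · subst hi
          rw [Function.update_self]
          exact Submodule.add_mem _ (hy i) (finiteWalk_mono (by omega) hb)
        · rw [Function.update_of_ne hi]; exact hy i)
      (by
        rw [← hsum, Finset.sum_range_succ, Finset.sum_range_succ, Finset.sum_range_succ,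
          Function.update_self, hyab]
        have h1 : ∑ i ∈ Finset.range n, Function.update y n (y n + b) i i =
            ∑ i ∈ Finset.range n, y i i := by
          refine Finset.sum_congr rfl fun i hi => ?_
          rw [Function.update_of_ne (Finset.mem_range.1 hi).ne]
        have h2 : a ((n + 1 : ℕ) : ℤ) = 0 := ha.2 _ (Or.inr le_rfl)
        rw [h1, Pi.add_apply, Pi.add_apply, h2, zero_add, shift_apply, add_assoc]
        congr 4
        push_cast; ring)
    intro i hi
    rcases (Nat.lt_succ_iff_lt_or_eq.1 hi) with hi' | rfl
    · have := key i hi'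
      by_cases hin : i = n
      · subst hin
        rw [Function.update_self] at this
        have hb' : b ∈ shorterWalk R d := Submodule.mem_sup_left hb
        simpa using Submodule.sub_mem _ this hb'
      · rwa [Function.update_of_ne hin] at this
    · exact hyn

/-- Walks longer than the nullity of a nilpotent symmetry of the relation are sums of shorter
walks. -/
theorem finiteWalk_le_shorterWalk [FiniteDimensional K W] {u : W →ₗ[K] W} (hu : IsNilpotent u)
    (hR : ∀ p ∈ R, (u p.1, u p.2) ∈ R) {d : ℕ}
    (hd : Module.finrank K (LinearMap.ker u) ≤ d) :
    finiteWalk R (d + 1) ≤ shorterWalk R d := by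
  let U : (ℤ → W) →ₗ[K] (ℤ → W) := LinearMap.compLeft u ℤ
  have hU_apply : ∀ x j, U x j = u (x j) := fun _ _ => rfl
  have hUM : ∀ {e : ℕ} {x}, x ∈ finiteWalk R e → U x ∈ finiteWalk R e := fun hx =>
    ⟨fun j => hR _ (hx.1 j), fun j hj => by rw [hU_apply, hx.2 j hj, map_zero]⟩
  have hUB : ∀ {x}, x ∈ shorterWalk R d → U x ∈ shorterWalk R d := by
    intro x hx
    obtain ⟨a, ha, _, ⟨b, hb, rfl⟩, rfl⟩ := Submodule.mem_sup.1 hx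
    rw [map_add]
    refine Submodule.add_mem_sup (hUM ha) ⟨U b, hUM hb, rfl⟩
  -- the span `X` of the positions, and its image under `u`
  let f : (Fin (d + 1) → finiteWalk R (d + 1)) →ₗ[K] W :=
    ∑ i : Fin (d + 1), (LinearMap.proj (i : ℤ)).comp
      ((finiteWalk R (d + 1)).subtype.comp (LinearMap.proj i))
  have hf : ∀ m, f m = ∑ i, (m i : ℤ → W) (i : ℕ) := by
    intro m; simp [f]
  let X := LinearMap.range f
  have hstep : ∀ x ∈ finiteWalk R (d + 1), ∃ m ∈ finiteWalk R (d + 1),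
      x + U m ∈ shorterWalk R d := by
    intro x hx
    have hxX : ∀ i : Fin (d + 1), x (i : ℕ) ∈ X := by
      intro i
      refine ⟨Pi.single i ⟨x, hx⟩, ?_⟩
      rw [hf, Finset.sum_eq_single i]
      · simp
      · intro j _ hj; simp [hj]
      · simp
    have hrank := finrank_map_add_finrank_inf_ker u X
    have hmap : X.map u ≤ X := by
      rintro _ ⟨_, ⟨m, rfl⟩, rfl⟩
      refine ⟨fun i => ⟨U (m i), hUM (m i).2⟩, ?_⟩
      simp [hf, hU_apply]
    have hnot : ¬ LinearIndependent K
        (fun i : Fin (d + 1) => (((X.map u).submoduleOf X).mkQ ⟨x (i : ℕ), hxX i⟩)) := by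
      intro h
      have h1 := h.fintype_card_le_finrank
      have h2 := Submodule.finrank_quotient_add_finrank ((X.map u).submoduleOf X)
      have h3 : Module.finrank K ((X.map u).submoduleOf X) = Module.finrank K (X.map u) :=
        (Submodule.submoduleOfEquivOfLe hmap).finrank_eq
      have h4 := Submodule.finrank_mono (inf_le_right : X ⊓ LinearMap.ker u ≤ LinearMap.ker u)
      rw [Fintype.card_fin] at h1
      omega
    obtain ⟨c, hc, i₀, hi₀⟩ := Fintype.not_linearIndependent_iff.1 hnot
    simp only [← map_smul, ← map_sum] at hc
    rw [Submodule.mkQ_apply, Submodule.Quotient.mk_eq_zero] at hc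
    obtain ⟨_, ⟨m, rfl⟩, hm⟩ := id hc
    have hy := mem_shorterWalk_of_sum_eq_zero (R := R) (d := d) (d + 1) le_rfl
      (fun i => if h : i < d + 1 then c ⟨i, h⟩ • x - U (m ⟨i, h⟩) else 0)
      (by
        intro i
        split_ifs with h
        · exact Submodule.sub_mem _ (Submodule.smul_mem _ _ hx) (hUM (m _).2)
        · exact Submodule.zero_mem _)
      (by
        rw [Finset.sum_range]
        simp only [Fin.is_lt, dite_true, Fin.eta, Pi.sub_apply, Pi.smul_apply, hU_apply,
          Finset.sum_sub_distrib]
        rw [sub_eq_zero, ← map_sum, ← hf, hm]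
        simp) i₀ i₀.2
    rw [dif_pos i₀.2] at hy
    refine ⟨-((c i₀)⁻¹ • (m i₀ : ℤ → W)),
      Submodule.neg_mem _ (Submodule.smul_mem _ _ (m i₀).2), ?_⟩
    have := Submodule.smul_mem _ (c i₀)⁻¹ hy
    rw [smul_sub, smul_smul, inv_mul_cancel₀ hi₀, one_smul] at this
    rw [map_neg, map_smul, ← sub_eq_add_neg]
    exact this
  -- iterate, until the power of `u` in the remainder vanishes
  have hiter : ∀ (k : ℕ), ∀ x ∈ finiteWalk R (d + 1), ∃ m ∈ finiteWalk R (d + 1),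
      x + (U ^ k) m ∈ shorterWalk R d := by
    intro k
    induction k with
    | zero => intro x hx; exact ⟨-x, Submodule.neg_mem _ hx, by simp⟩
    | succ k ih =>
      intro x hx
      obtain ⟨m, hm, h⟩ := ih x hx
      obtain ⟨m', hm', h'⟩ := hstep m hm
      refine ⟨-m', Submodule.neg_mem _ hm', ?_⟩
      have hk : ∀ (k : ℕ) {y}, y ∈ shorterWalk R d → (U ^ k) y ∈ shorterWalk R d := by
        intro k
        induction k with
        | zero => intro y hy; simpa using hy
        | succ k ih => intro y hy; rw [pow_succ]; exact ih (hUB hy)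
      have := Submodule.sub_mem _ h (hk k h')
      rw [map_add, ← sub_sub, add_sub_cancel_right] at this
      rw [pow_succ, map_neg, ← sub_eq_add_neg]
      exact this
  intro x hx
  obtain ⟨k, hk⟩ := hu
  obtain ⟨m, -, h⟩ := hiter k x hx
  have hUk : (U ^ k) m = 0 := by
    have : ∀ (k : ℕ) j, (U ^ k) m j = (u ^ k) (m j) := by
      intro k
      induction k with
      | zero => intro j; rfl
      | succ k ih => intro j; rw [pow_succ', pow_succ']; exact congrArg u (ih j)
    ext j
    rw [this, hk]; rfl
  rwa [hUk, add_zero] at h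

/-- Up to a difference of translates, a finite walk is no longer than the nullity of a nilpotent
symmetry of the relation. -/
theorem exists_finiteWalk_add_shift_sub [FiniteDimensional K W] {u : W →ₗ[K] W}
    (hu : IsNilpotent u) (hR : ∀ p ∈ R, (u p.1, u p.2) ∈ R) {e : ℕ}
    (he : Module.finrank K (LinearMap.ker u) ≤ e) (d : ℕ) :
    ∀ x ∈ finiteWalk R d, ∃ y ∈ finiteWalk R e, ∃ b ∈ finiteWalk R (d - 1),
      x = y + (shift K 1 b - b) := by
  induction d with
  | zero =>
    intro x hx
    exact ⟨x, finiteWalk_mono (Nat.zero_le _) hx, 0, Submodule.zero_mem _, by simp⟩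
  | succ d ih =>
    intro x hx
    rcases Nat.lt_or_ge d e with h | h
    · exact ⟨x, finiteWalk_mono h hx, 0, Submodule.zero_mem _, by simp⟩
    obtain ⟨a, ha, _, ⟨b, hb, rfl⟩, rfl⟩ :=
      Submodule.mem_sup.1 (finiteWalk_le_shorterWalk hu hR (he.trans h) hx)
    obtain ⟨y, hy, b', hb', h'⟩ := ih (a + b) (Submodule.add_mem _ ha hb)
    refine ⟨y, hy, b' + b, Submodule.add_mem _ (finiteWalk_mono (by omega) hb') hb, ?_⟩
    have h2 : a = y + (shift K 1 b' - b') - b := eq_sub_of_add_eq h'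
    rw [h2, map_add]
    abel

end Walks

end STS

/-! ### Pauli operators up to phase as configurations -/

namespace STS

/-- The Pauli operators on one composite particle, up to phase. -/
abbrev Cell (v : ℕ) : Type := Fin v → ZMod 2 × ZMod 2

/-- The symplectic form on one composite particle, which vanishes on commuting operators. -/
def cellForm (v : ℕ) : LinearMap.BilinForm (ZMod 2) (Cell v) :=
  LinearMap.mk₂ (ZMod 2) (fun a b => ∑ i, ((a i).1 * (b i).2 + (a i).2 * (b i).1))
    (by
      intros
      rw [← Finset.sum_add_distrib]
      exact Finset.sum_congr rfl fun i _ => by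
        simp only [Pi.add_apply, Prod.fst_add, Prod.snd_add]; ring)
    (by
      intros
      rw [smul_eq_mul, Finset.mul_sum]
      exact Finset.sum_congr rfl fun i _ => by
        simp only [Pi.smul_apply, Prod.smul_fst, Prod.smul_snd, smul_eq_mul]; ring)
    (by
      intros
      rw [← Finset.sum_add_distrib]
      exact Finset.sum_congr rfl fun i _ => by
        simp only [Pi.add_apply, Prod.fst_add, Prod.snd_add]; ring)
    (by
      intros
      rw [smul_eq_mul, Finset.mul_sum]
      exact Finset.sum_congr rfl fun i _ => by
        simp only [Pi.smul_apply, Prod.smul_fst, Prod.smul_snd, smul_eq_mul]; ring)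

theorem cellForm_apply {v : ℕ} (a b : Cell v) :
    cellForm v a b = ∑ i, ((a i).1 * (b i).2 + (a i).2 * (b i).1) := rfl

theorem cellForm_comm {v : ℕ} (a b : Cell v) : cellForm v a b = cellForm v b a := by
  simp only [cellForm_apply]
  exact Finset.sum_congr rfl fun i _ => by ring

theorem eq_zero_of_cellForm_eq_zero {v : ℕ} (a : Cell v) (h : ∀ b, cellForm v b a = 0) : a = 0 := by
  ext i
  · have := h (Pi.single i (0, 1))
    rw [cellForm_apply, Finset.sum_eq_single i] at this
    · simpa using this
    · intro j _ hj; simp [hj]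
    · simp
  · have := h (Pi.single i (1, 0))
    rw [cellForm_apply, Finset.sum_eq_single i] at this
    · simpa using this
    · intro j _ hj; simp [hj]
    · simp

theorem finrank_cell (v : ℕ) : Module.finrank (ZMod 2) (Cell v) = 2 * v := by
  rw [Module.finrank_pi_fintype]
  simp [mul_comm]

theorem signExp_eq (a b : ZMod 2) : signExp a b = signExp (a * b) 1 := by
  revert a b; decide

section Lattice

variable {v : ℕ} {n : Fin 3 → ℕ+}

theorem finrank_configurations (v : ℕ) (n : Fin 3 → ℕ+) :
    Module.finrank (ZMod 2) (Site n → Cell v) = 2 * (v * ((n 0 : ℕ) * n 1 * n 2)) := by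
  rw [Module.finrank_pi_fintype, Finset.sum_const, finrank_cell, Finset.card_univ, Fintype.card_pi,
    Fin.prod_univ_three, smul_eq_mul]
  simp only [ZMod.card]
  ring

/-- The configuration of a Pauli operator: its `X` and `Z` exponents, without its phase. -/
def config (U : Pauli (Qubit v n)) : Site n → Cell v := fun s i => (U.x (s, i), U.z (s, i))

theorem config_mul (U W : Pauli (Qubit v n)) : config (U * W) = config U + config W := rfl

theorem config_scalar (p : ZMod 4) : config (Pauli.scalar p : Pauli (Qubit v n)) = 0 := rfl

/-- The operator without phase with a given configuration. -/
def ofConfig (p : Site n → Cell v) : Pauli (Qubit v n) :=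
  ⟨0, fun q => (p q.1 q.2).1, fun q => (p q.1 q.2).2⟩

theorem config_ofConfig (p : Site n → Cell v) : config (ofConfig p) = p := rfl

theorem scalar_mul (p : ZMod 4) (U : Pauli (Qubit v n)) :
    Pauli.scalar p * U = ⟨p + U.phase, U.x, U.z⟩ := by
  rw [Pauli.mul_def]
  ext <;> simp [Pauli.scalar, signExp]

theorem eq_scalar_mul_of_config_eq {U W : Pauli (Qubit v n)} (h : config U = config W) :
    U = Pauli.scalar (U.phase - W.phase) * W := by
  rw [scalar_mul]
  ext q
  · simp
  · exact congrArg Prod.fst (congrFun (congrFun h q.1) q.2)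
  · exact congrArg Prod.snd (congrFun (congrFun h q.1) q.2)

theorem mul_comm_iff (U W : Pauli (Qubit v n)) :
    U * W = W * U ↔ latticeForm (Site n) (cellForm v) (config U) (config W) = 0 := by
  let f : ZMod 2 →+ ZMod 4 :=
    AddMonoidHom.mk' (fun a => signExp a 1) fun a b => signExp_add_left a b 1
  have hf : ∀ a b, signExp a b = f (a * b) := signExp_eq
  have hinj : ∀ a, f a = 0 → a = 0 := by
    change ∀ a, signExp a 1 = 0 → a = 0
    decide
  have hform : latticeForm (Site n) (cellForm v) (config U) (config W) =
      ∑ q, U.z q * W.x q - ∑ q, W.z q * U.x q := by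
    rw [CharTwo.sub_eq_add, ← Finset.sum_add_distrib, Fintype.sum_prod_type, latticeForm_apply]
    refine Finset.sum_congr rfl fun s _ => ?_
    rw [cellForm_apply]
    refine Finset.sum_congr rfl fun i _ => ?_
    simp only [config]
    ring
  have h1 : U * W = W * U ↔
      ∑ q, signExp (U.z q) (W.x q) = ∑ q, signExp (W.z q) (U.x q) := by
    rw [Pauli.mul_def, Pauli.mul_def]
    constructor
    · intro h
      have := congrArg Pauli.phase h
      simp only at this
      linear_combination this
    · intro h
      rw [h]
      ext <;> simp [add_comm]
  rw [h1, hform, ← sub_eq_zero]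
  simp only [hf, ← map_sum, ← map_sub]
  exact ⟨hinj _, fun h => by rw [h, map_zero]⟩

theorem config_mem_span {X : Set (Pauli (Qubit v n))} {U : Pauli (Qubit v n)}
    (hU : U ∈ Subgroup.closure X) : config U ∈ Submodule.span (ZMod 2) (config '' X) := by
  induction hU using Subgroup.closure_induction with
  | mem U h => exact Submodule.subset_span ⟨U, h, rfl⟩
  | one => exact Submodule.zero_mem _
  | mul U W _ _ hU hW => exact Submodule.add_mem _ hU hW
  | inv U _ hU => exact hU

theorem exists_config_eq {X : Set (Pauli (Qubit v n))} {p : Site n → Cell v}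
    (hp : p ∈ Submodule.span (ZMod 2) (config '' X)) : ∃ U ∈ Subgroup.closure X, config U = p := by
  induction hp using Submodule.span_induction with
  | mem p h =>
    obtain ⟨U, hU, rfl⟩ := h
    exact ⟨U, Subgroup.subset_closure hU, rfl⟩
  | zero => exact ⟨1, Subgroup.one_mem _, rfl⟩
  | add p q _ _ hp hq =>
    obtain ⟨U, hU, rfl⟩ := hp
    obtain ⟨W, hW, rfl⟩ := hq
    exact ⟨U * W, Subgroup.mul_mem _ hU hW, rfl⟩
  | smul c p _ hp =>
    obtain ⟨U, hU, rfl⟩ := hp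
    have hc : c = 0 ∨ c = 1 := by revert c; decide
    rcases hc with rfl | rfl
    · exact ⟨1, Subgroup.one_mem _, by rw [zero_smul]; rfl⟩
    · exact ⟨U, hU, by rw [one_smul]⟩

/-! ### The space of stabilizers -/

/-- The point of the `2 × 2 × 2` block with corner `0` on the torus. -/
def offset (n : Fin 3 → ℕ+) (c : Corner) : Site n := fun m => ((c m : ℕ) : ZMod (n m : ℕ))

/-- The configuration of an interaction term placed on the torus at `r`. -/
def termConfig (n : Fin 3 → ℕ+) (g : Pauli (Corner × Fin v)) (r : Site n) : Site n → Cell v :=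
  ∑ c : Corner, Pi.single (r + offset n c) fun i => (g.x (c, i), g.z (c, i))

theorem sum_corners {N : Type*} [AddCommMonoid N] (f : Corner → N) :
    (corners.map f).sum = ∑ c, f c := by
  have h1 : corners.Nodup := by decide
  have h2 : corners.toFinset = Finset.univ := by decide
  rw [← h2, List.sum_toFinset f h1]

theorem config_atSite (s : Site n) (a b : Fin v → ZMod 2) :
    config (atSite s a b) = Pi.single s fun i => (a i, b i) := by
  ext s' i
  · by_cases h : s' = s
    · subst h; simp [config, atSite]
    · rw [Pi.single_eq_of_ne h]; simp [config, atSite, h]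
  · by_cases h : s' = s
    · subst h; simp [config, atSite]
    · rw [Pi.single_eq_of_ne h]; simp [config, atSite, h]

theorem config_place (g : Pauli (Corner × Fin v)) (r : Site n) :
    config (place n g r) = termConfig n g r := by
  have hlist : ∀ l : List (Pauli (Qubit v n)), config l.prod = (l.map config).sum := by
    intro l
    induction l with
    | nil => rfl
    | cons U l ih => rw [List.prod_cons, config_mul, ih, List.map_cons, List.sum_cons]
  rw [place, config_mul, config_scalar, zero_add, hlist, List.map_map, sum_corners, termConfig]
  exact Finset.sum_congr rfl fun c _ => config_atSite _ _ _

/-- The configurations of the stabilizers. -/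
def stabSpace (terms : Set (Pauli (Corner × Fin v))) (n : Fin 3 → ℕ+) :
    Submodule (ZMod 2) (Site n → Cell v) :=
  Submodule.span (ZMod 2) {p | ∃ g ∈ terms, ∃ r : Site n, p = termConfig n g r}

variable {terms : Set (Pauli (Corner × Fin v))}

theorem stabSpace_eq : stabSpace terms n =
    Submodule.span (ZMod 2) (config '' {U | ∃ g ∈ terms, ∃ r : Site n, U = place n g r}) := by
  rw [stabSpace]
  congr 1
  ext p
  constructor
  · rintro ⟨g, hg, r, rfl⟩
    exact ⟨_, ⟨g, hg, r, rfl⟩, config_place g r⟩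
  · rintro ⟨_, ⟨g, hg, r, rfl⟩, rfl⟩
    exact ⟨g, hg, r, config_place g r⟩

theorem config_mem_stabSpace {U : Pauli (Qubit v n)} (hU : U ∈ stabilizer terms n) :
    config U ∈ stabSpace terms n := by
  rw [stabSpace_eq]; exact config_mem_span hU

theorem exists_mem_stabilizer {p : Site n → Cell v} (hp : p ∈ stabSpace terms n) :
    ∃ U ∈ stabilizer terms n, config U = p := by
  rw [stabSpace_eq] at hp; exact exists_config_eq hp

/-- The configurations of the operators which commute with all stabilizers. -/
def logicalSpace (terms : Set (Pauli (Corner × Fin v))) (n : Fin 3 → ℕ+) :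
    Submodule (ZMod 2) (Site n → Cell v) :=
  (latticeForm (Site n) (cellForm v)).orthogonal (stabSpace terms n)

theorem mem_logicalSpace_iff {p : Site n → Cell v} : p ∈ logicalSpace terms n ↔
    ∀ g ∈ terms, ∀ r, latticeForm (Site n) (cellForm v) (termConfig n g r) p = 0 := by
  constructor
  · intro h g hg r
    exact h _ (Submodule.subset_span ⟨g, hg, r, rfl⟩)
  · intro h s hs
    change latticeForm (Site n) (cellForm v) s p = 0
    induction hs using Submodule.span_induction with
    | mem s hs =>
      obtain ⟨g, hg, r, rfl⟩ := hs
      exact h g hg r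
    | zero => simp
    | add s t _ _ hs ht => rw [map_add, LinearMap.add_apply, hs, ht, add_zero]
    | smul c s _ hs => rw [map_smul, LinearMap.smul_apply, hs, smul_zero]

theorem mem_centralizer_iff (M : Model v) {U : Pauli (Qubit v n)} :
    U ∈ M.centralizer n ↔ config U ∈ logicalSpace M.terms n := by
  rw [Model.centralizer, Subgroup.mem_centralizer_iff]
  constructor
  · intro h p hp
    obtain ⟨W, hW, rfl⟩ := exists_mem_stabilizer hp
    exact (mul_comm_iff W U).1 (h W hW)
  · intro h W hW
    exact (mul_comm_iff W U).2 (h _ (config_mem_stabSpace hW))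

theorem latticeForm_eq_zero_of_mem_stabSpace (M : Model v) (hn : ∀ m, 2 ≤ (n m : ℕ))
    {p q : Site n → Cell v} (hp : p ∈ stabSpace M.terms n) (hq : q ∈ stabSpace M.terms n) :
    latticeForm (Site n) (cellForm v) p q = 0 := by
  obtain ⟨U, hU, rfl⟩ := exists_mem_stabilizer hp
  obtain ⟨W, hW, rfl⟩ := exists_mem_stabilizer hq
  exact (mul_comm_iff U W).1 (M.commute n hn U hU W hW)

theorem scalar_mem_stabilizer (M : Model v) (hn : ∀ m, 2 ≤ (n m : ℕ)) {p : ZMod 4}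
    (hp : Pauli.scalar p ∈ stabilizer M.terms n) : p = 0 := by
  have h2 := M.neg_one_notMem n hn
  have hmul : (Pauli.scalar (p + p) : Pauli (Qubit v n)) ∈ stabilizer M.terms n := by
    have := Subgroup.mul_mem _ hp hp
    rwa [scalar_mul] at this
  by_contra h0
  have : p = 2 ∨ p + p = 2 := by
    revert h0; clear hp hmul; revert p; decide
  rcases this with h | h
  · rw [h] at hp; exact h2 hp
  · rw [h] at hmul; exact h2 hmul

/-- Stabilizers are determined by their configurations, so independent generators of the stabilizer
group are the same as a basis of the space of stabilizers. -/
theorem rank_stabilizer (M : Model v) (hn : ∀ m, 2 ≤ (n m : ℕ)) :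
    Group.rank (stabilizer M.terms n) = Module.finrank (ZMod 2) (stabSpace M.terms n) := by
  have hinj : ∀ U ∈ stabilizer M.terms n, ∀ W ∈ stabilizer M.terms n,
      config U = config W → U = W := by
    intro U hU W hW h
    have h1 := eq_scalar_mul_of_config_eq h
    have h2 : (Pauli.scalar (U.phase - W.phase) : Pauli (Qubit v n)) ∈ stabilizer M.terms n := by
      have := Subgroup.mul_mem _ hU (Subgroup.inv_mem _ hW)
      rwa [h1, mul_inv_cancel_right] at this
    rw [scalar_mem_stabilizer M hn h2] at h1
    rw [h1, scalar_mul, zero_add]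
  have hcl : ∀ X : Set (stabilizer M.terms n), (Subgroup.closure X).map (Subgroup.subtype _) =
      Subgroup.closure (Subtype.val '' X) := fun X => MonoidHom.map_closure _ _
  classical
  apply le_antisymm
  · let b := Module.finBasis (ZMod 2) (stabSpace M.terms n)
    choose U hU hUb using fun i => exists_mem_stabilizer (b i).2
    let X : Finset (stabilizer M.terms n) :=
      Finset.univ.image fun i => (⟨U i, hU i⟩ : stabilizer M.terms n)
    have hX : Subgroup.closure (X : Set (stabilizer M.terms n)) = ⊤ := by
      rw [eq_top_iff]
      rintro ⟨W, hW⟩ -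
      have hspan : config W ∈ Submodule.span (ZMod 2)
          (config '' (Subtype.val '' (X : Set (stabilizer M.terms n)))) := by
        have h1 := b.mem_span ⟨config W, config_mem_stabSpace hW⟩
        have h2 := Submodule.mem_map_of_mem (f := (stabSpace M.terms n).subtype) h1
        rw [Submodule.map_span] at h2
        refine Submodule.span_mono ?_ h2
        rintro _ ⟨_, ⟨i, rfl⟩, rfl⟩
        exact ⟨U i, ⟨⟨U i, hU i⟩, by simp [X], rfl⟩, hUb i⟩
      obtain ⟨W', hW', h⟩ := exists_config_eq hspan
      rw [← hcl] at hW'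
      obtain ⟨⟨W'', hW''⟩, hmem, rfl⟩ := hW'
      have : W'' = W := hinj _ hW'' _ hW h
      subst this
      exact hmem
    refine (Group.rank_le hX).trans (Finset.card_image_le.trans ?_)
    simp
  · obtain ⟨X, hX, hcX⟩ := Group.rank_spec (stabilizer M.terms n)
    rw [← hX]
    let Y : Finset (Site n → Cell v) := X.image fun U => config U.1
    have hle : stabSpace M.terms n ≤ Submodule.span (ZMod 2) (Y : Set (Site n → Cell v)) := by
      intro p hp
      obtain ⟨U, hU, rfl⟩ := exists_mem_stabilizer hp
      have h1 : U ∈ (Subgroup.closure (X : Set (stabilizer M.terms n))).map (Subgroup.subtype _) :=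
        ⟨⟨U, hU⟩, by rw [hcX]; exact Subgroup.mem_top _, rfl⟩
      rw [hcl] at h1
      have h2 := config_mem_span h1
      rwa [Set.image_image, ← Finset.coe_image] at h2
    exact (Submodule.finrank_mono hle).trans
      ((finrank_span_finset_le_card Y).trans Finset.card_image_le)

theorem finrank_stabSpace (M : Model v) (hn : ∀ m, 2 ≤ (n m : ℕ)) :
    Module.finrank (ZMod 2) (stabSpace M.terms n) + M.k = v * ((n 0 : ℕ) * n 1 * n 2) := by
  rw [← rank_stabilizer M hn]
  exact M.scale n hn

theorem shift_termConfig (g : Pauli (Corner × Fin v)) (r t : Site n) :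
    shift (ZMod 2) t (termConfig n g r) = termConfig n g (r + t) := by
  simp only [termConfig, map_sum, shift_single]
  exact Finset.sum_congr rfl fun c _ => by rw [add_right_comm]

theorem shift_mem_stabSpace (t : Site n) {p : Site n → Cell v} (hp : p ∈ stabSpace terms n) :
    shift (ZMod 2) t p ∈ stabSpace terms n := by
  have : (stabSpace terms n).map (shift (ZMod 2) t) ≤ stabSpace terms n := by
    rw [stabSpace, Submodule.map_span, Submodule.span_le]
    rintro _ ⟨_, ⟨g, hg, r, rfl⟩, rfl⟩
    exact Submodule.subset_span ⟨g, hg, r + t, shift_termConfig g r t⟩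
  exact this (Submodule.mem_map_of_mem hp)

theorem shift_mem_logicalSpace (t : Site n) {p : Site n → Cell v} (hp : p ∈ logicalSpace terms n) :
    shift (ZMod 2) t p ∈ logicalSpace terms n := by
  intro s hs
  change latticeForm (Site n) (cellForm v) s _ = 0
  rw [← neg_neg t, ← latticeForm_shift_left]
  exact hp _ (shift_mem_stabSpace _ hs)

end Lattice

end STS

/-! ### Tori covering each other -/

namespace STS

section Covers

variable {v : ℕ} {n n' : Fin 3 → ℕ+} {terms : Set (Pauli (Corner × Fin v))}

/-- The projection of a torus onto a torus whose side lengths divide those of the first one. -/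
def reduce (h : ∀ m, (n m : ℕ) ∣ n' m) : Site n' →+ Site n where
  toFun r m := ZMod.castHom (h m) (ZMod (n m : ℕ)) (r m)
  map_zero' := by ext m; simp only [Pi.zero_apply, map_zero]
  map_add' r s := by ext m; simp only [Pi.add_apply, map_add]

theorem reduce_apply (h : ∀ m, (n m : ℕ) ∣ n' m) (r : Site n') (m : Fin 3) :
    reduce h r m = ZMod.castHom (h m) (ZMod (n m : ℕ)) (r m) := rfl

theorem reduce_surjective (h : ∀ m, (n m : ℕ) ∣ n' m) : Function.Surjective (reduce h) := by
  intro r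
  choose s hs using fun m => ZMod.castHom_surjective (h m) (r m)
  exact ⟨s, funext hs⟩

theorem reduce_offset (h : ∀ m, (n m : ℕ) ∣ n' m) (c : Corner) :
    reduce h (offset n' c) = offset n c := by
  ext m
  simp only [reduce_apply, offset, map_natCast]

theorem push_termConfig (h : ∀ m, (n m : ℕ) ∣ n' m) (g : Pauli (Corner × Fin v)) (r : Site n') :
    push (ZMod 2) (reduce h) (termConfig n' g r) = termConfig n g (reduce h r) := by
  simp only [termConfig, map_sum, push_single, map_add, reduce_offset]

theorem map_push_stabSpace (h : ∀ m, (n m : ℕ) ∣ n' m) :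
    (stabSpace terms n').map (push (ZMod 2) (reduce h)) = stabSpace terms n := by
  rw [stabSpace, stabSpace, Submodule.map_span]
  congr 1
  ext p
  constructor
  · rintro ⟨_, ⟨g, hg, r, rfl⟩, rfl⟩
    exact ⟨g, hg, reduce h r, push_termConfig h g r⟩
  · rintro ⟨g, hg, r, rfl⟩
    obtain ⟨r, rfl⟩ := reduce_surjective h r
    exact ⟨_, ⟨g, hg, r, rfl⟩, push_termConfig h g r⟩

theorem pull_mem_logicalSpace (h : ∀ m, (n m : ℕ) ∣ n' m) {p : Site n → Cell v}
    (hp : p ∈ logicalSpace terms n) :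
    pull (ZMod 2) (reduce h) p ∈ logicalSpace terms n' := by
  intro s hs
  change latticeForm _ _ s _ = 0
  rw [← latticeForm_push_left]
  exact hp _ (map_push_stabSpace h ▸ Submodule.mem_map_of_mem hs)

/-- The site at distance `k` from the origin in the first direction. -/
def along (n : Fin 3 → ℕ+) (k : ℕ) : Site n := Pi.single 0 (k : ZMod (n 0 : ℕ))

theorem along_add (k l : ℕ) : along n (k + l) = along n k + along n l := by
  rw [along, Nat.cast_add, Pi.single_add]; rfl

theorem nsmul_along (k l : ℕ) : k • along n l = along n (k * l) := by
  rw [along, along, ← Pi.single_smul, nsmul_eq_mul, Nat.cast_mul]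

theorem reduce_along (h : ∀ m, (n m : ℕ) ∣ n' m) (k : ℕ) :
    reduce h (along n' k) = along n k := by
  ext m
  rw [reduce_apply, along, along]
  by_cases hm : m = 0
  · subst hm; simp
  · rw [Pi.single_eq_of_ne hm, Pi.single_eq_of_ne hm, map_zero]

theorem along_self : along n (n 0) = 0 := by
  rw [along, ZMod.natCast_self, Pi.single_zero]

theorem eq_along_of_reduce_eq_zero (h : ∀ m, (n m : ℕ) ∣ n' m) (h0 : ∀ m, m ≠ 0 → n' m = n m)
    {r : Site n'} (hr : reduce h r = 0) : ∃ k : ℕ, k * n 0 < n' 0 ∧ r = along n' (k * n 0) := by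
  have hdvd : ∀ m, (n m : ℕ) ∣ (r m).val := by
    intro m
    have := congrFun hr m
    rwa [reduce_apply, ← ZMod.natCast_zmod_val (r m), map_natCast, Pi.zero_apply,
      ZMod.natCast_eq_zero_iff] at this
  obtain ⟨k, hk⟩ := hdvd 0
  rw [mul_comm] at hk
  refine ⟨k, hk ▸ ZMod.val_lt (r 0), ?_⟩
  ext m
  rw [along]
  by_cases hm : m = 0
  · subst hm
    rw [Pi.single_eq_same, ← hk, ZMod.natCast_zmod_val]
  · rw [Pi.single_eq_of_ne hm, ← ZMod.val_eq_zero]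
    refine Nat.eq_zero_of_dvd_of_lt (hdvd m) ?_
    rw [← h0 m hm]
    exact ZMod.val_lt (r m)

/-- For tori `n'` and `n` which differ in the first direction only, the translation by the length of
`n` acts trivially on the logical operators of `n'` exactly if both encode the same number of
logical qubits. -/
theorem shift_along_sub_mem_iff (M : Model v) (hn' : ∀ m, 2 ≤ (n' m : ℕ))
    (h : (n 0 : ℕ) ∣ n' 0) (h0 : ∀ m, m ≠ 0 → n' m = n m) :
    (∀ c ∈ logicalSpace M.terms n', shift (ZMod 2) (along n' (n 0)) c - c ∈ stabSpace M.terms n') ↔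
      2 * Module.finrank (ZMod 2) (stabSpace M.terms n') +
          Module.finrank (ZMod 2) (Site n → Cell v) =
        Module.finrank (ZMod 2) (Site n' → Cell v) +
          2 * Module.finrank (ZMod 2) (stabSpace M.terms n) := by
  let d : Fin 3 → ℕ+ := Function.update n' 0 (2 * n' 0)
  have hd0 : (d 0 : ℕ) = 2 * n' 0 := by simp [d]
  have hdm : ∀ m, m ≠ 0 → d m = n' m := fun m hm => Function.update_of_ne hm _ _
  have hdvd : ∀ m, (n' m : ℕ) ∣ d m := by
    intro m
    by_cases hm : m = 0
    · subst hm; rw [hd0]; exact Dvd.intro_left 2 rfl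
    · rw [hdm m hm]
  have hall : ∀ m, (n m : ℕ) ∣ n' m := by
    intro m
    by_cases hm : m = 0
    · subst hm; exact h
    · rw [h0 m hm]
  have hd2 : ∀ m, 2 ≤ (d m : ℕ) := by
    intro m
    by_cases hm : m = 0
    · subst hm; rw [hd0]; have := (n' 0).pos; omega
    · rw [hdm m hm]; exact hn' m
  have hcomp : ∀ a, reduce hall (reduce hdvd a) = reduce (fun m => (hall m).trans (hdvd m)) a := by
    intro a
    obtain ⟨a, rfl⟩ : ∃ b : Fin 3 → ℕ, (fun m => ((b m : ℕ) : ZMod (d m : ℕ))) = a :=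
      ⟨fun m => (a m).val, funext fun m => ZMod.natCast_zmod_val (a m)⟩
    ext m
    simp only [reduce_apply, map_natCast]
  have key := shift_sub_mem_iff (ω := cellForm v) cellForm_comm eq_zero_of_cellForm_eq_zero
    (reduce_surjective hdvd) (reduce_surjective hall) (t' := along d (n 0)) (w := along d (n' 0))
    (by
      intro hw
      have := congrFun hw 0
      rw [along, Pi.single_eq_same, Pi.zero_apply, ZMod.natCast_eq_zero_iff, hd0] at this
      have h1 := Nat.le_of_dvd (n' 0).pos this
      have := (n' 0).pos
      omega)
    (by
      intro a
      constructor
      · intro ha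
        obtain ⟨k, hk, rfl⟩ := eq_along_of_reduce_eq_zero hdvd hdm ha
        rw [hd0] at hk
        have hk2 : k < 2 := lt_of_mul_lt_mul_right hk (Nat.zero_le _)
        have hk3 : k = 0 ∨ k = 1 := by omega
        rcases hk3 with rfl | rfl
        · left; simp [along]
        · right; rw [one_mul]
      · rintro (rfl | rfl)
        · exact map_zero _
        · rw [reduce_along, along_self])
    (by
      intro a ha
      rw [hcomp] at ha
      obtain ⟨k, -, rfl⟩ := eq_along_of_reduce_eq_zero _
        (fun m hm => (hdm m hm).trans (h0 m hm)) ha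
      exact ⟨k, (nsmul_along k _).symm⟩)
    (by
      intro a ha
      obtain ⟨k, -, rfl⟩ := eq_along_of_reduce_eq_zero _ h0 ha
      exact ⟨k, by rw [reduce_along, nsmul_along]⟩)
    (by rw [reduce_along, reduce_along, along_self])
    (map_push_stabSpace (terms := M.terms) hdvd) (map_push_stabSpace hall)
    (fun t p hp => shift_mem_stabSpace t hp)
    (fun p hp q hq => latticeForm_eq_zero_of_mem_stabSpace M hd2 hp hq)
  rw [reduce_along] at key
  exact key

theorem shift_one_sub_mem_of_two_le (M : Model v) (hn : ∀ m, 2 ≤ (n m : ℕ)) :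
    ∀ c ∈ logicalSpace M.terms n, shift (ZMod 2) (along n 1) c - c ∈ stabSpace M.terms n := by
  let s : ℕ+ → Fin 3 → ℕ+ := fun a => Function.update n 0 a
  have s0 : ∀ a, s a 0 = a := fun a => Function.update_self 0 a n
  have sm : ∀ a m, m ≠ 0 → s a m = n m := fun a m hm => Function.update_of_ne hm _ _
  have hs2 : ∀ a : ℕ+, 2 ≤ (a : ℕ) → ∀ m, 2 ≤ (s a m : ℕ) := by
    intro a ha m
    by_cases hm : m = 0
    · subst hm; rw [s0]; exact ha
    · rw [sm a m hm]; exact hn m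
  have hdim : ∀ a, Module.finrank (ZMod 2) (Site (s a) → Cell v) =
      2 * (v * ((a : ℕ) * n 1 * n 2)) := by
    intro a
    rw [finrank_configurations, s0, sm a 1 (by decide), sm a 2 (by decide)]
  have hS : ∀ a : ℕ+, 2 ≤ (a : ℕ) → Module.finrank (ZMod 2) (stabSpace M.terms (s a)) + M.k =
      v * ((a : ℕ) * n 1 * n 2) := by
    intro a ha
    have := finrank_stabSpace M (hs2 a ha)
    rwa [s0, sm a 1 (by decide), sm a 2 (by decide)] at this
  have hiff : ∀ a b : ℕ+, 2 ≤ (b : ℕ) → (a : ℕ) ∣ b → _ := fun a b hb hab =>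
    shift_along_sub_mem_iff (n := s a) (n' := s b) M (hs2 b hb) (by rw [s0, s0]; exact hab)
      (fun m hm => by rw [sm a m hm, sm b m hm])
  simp only [s0, hdim] at hiff
  -- on the torus of length six, the translations by two and by three act trivially
  have h6 := hS 6 (by decide)
  have h62 := (hiff 2 6 (by decide) (by decide)).2 (by
    have := hS 2 (by decide)
    omega)
  have h63 := (hiff 3 6 (by decide) (by decide)).2 (by
    have := hS 3 (by decide)
    omega)
  -- hence so does the unit translation, and so the torus of length one has `k` logical qubits too
  have h61 := (hiff 1 6 (by decide) (by decide)).1 (by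
    intro c hc
    have h := Submodule.sub_mem _ (h63 c hc) (h62 c hc)
    rw [sub_sub_sub_cancel_right] at h
    have h' := shift_mem_stabSpace (-along (s 6) ((2 : ℕ+) : ℕ)) h
    rw [map_sub, shift_shift, shift_shift, neg_add_cancel, shift_zero] at h'
    have h3 : along (s 6) ((3 : ℕ+) : ℕ) =
        along (s 6) ((2 : ℕ+) : ℕ) + along (s 6) ((1 : ℕ+) : ℕ) := along_add 2 1
    rw [h3, neg_add_cancel_left] at h'
    exact h')
  have hn0 := hS (n 0) (hn 0)
  have := (hiff 1 (n 0) (hn 0) (one_dvd _)).2 (by omega)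
  have hsn : s (n 0) = n := Function.update_eq_self 0 n
  rw [hsn] at this
  exact this

/-- Unfolding along a covering of odd degree and folding again changes nothing modulo two. -/
theorem push_pull_of_odd {A B E : Type*} [AddCommGroup A] [Fintype A] [AddCommGroup B]
    [Fintype B] [DecidableEq B] [AddCommGroup E] [Module (ZMod 2) E] {φ : A →+ B}
    (hφ : Function.Surjective φ) {k : ℕ} (hodd : Odd k)
    (hk : Fintype.card A = k * Fintype.card B) (p : B → E) :
    push (ZMod 2) φ (pull (ZMod 2) φ p) = p := by
  have hcard : ∀ b, (Finset.univ.filter fun a => φ a = b).card = k := by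
    intro b
    have h1 : Fintype.card A = ∑ b' : B, (Finset.univ.filter fun a => φ a = b').card :=
      Finset.card_eq_sum_card_fiberwise fun a _ => Finset.mem_coe.2 (Finset.mem_univ _)
    have h2 : ∀ b', (Finset.univ.filter fun a => φ a = b').card =
        (Finset.univ.filter fun a => φ a = b).card := fun b' =>
      AddMonoidHom.card_fiber_eq_of_mem_range φ (hφ b') (hφ b)
    rw [Finset.sum_congr rfl fun b' _ => h2 b', Finset.sum_const, Finset.card_univ, hk,
      smul_eq_mul, mul_comm] at h1
    exact (Nat.eq_of_mul_eq_mul_left (Fintype.card_pos_iff.2 ⟨b⟩) h1).symm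
  ext b
  rw [push_apply, Finset.sum_congr rfl (g := fun _ => p b) fun a ha => by
    rw [pull_apply, (Finset.mem_filter.1 ha).2], Finset.sum_const, hcard]
  obtain ⟨l, rfl⟩ := hodd
  rw [add_nsmul, one_nsmul, mul_comm, mul_nsmul, two_nsmul, ZModModule.add_self, zero_add]

/-- The unit translation acts trivially on logical operators. A torus of width one in the third
direction inherits this from the torus of width three, which covers it an odd number of times. -/
theorem shift_one_sub_mem (M : Model v) (hn0 : 2 ≤ (n 0 : ℕ)) (hn1 : 2 ≤ (n 1 : ℕ)) :
    ∀ c ∈ logicalSpace M.terms n, shift (ZMod 2) (along n 1) c - c ∈ stabSpace M.terms n := by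
  intro c hc
  let d : Fin 3 → ℕ+ := Function.update n 2 (3 * n 2)
  have hd0 : d 0 = n 0 := Function.update_of_ne (by decide) _ _
  have hd1 : d 1 = n 1 := Function.update_of_ne (by decide) _ _
  have hd2 : (d 2 : ℕ) = 3 * n 2 := by simp [d]
  have hdvd : ∀ m, (n m : ℕ) ∣ d m := by
    intro m
    fin_cases m
    · exact dvd_of_eq (congrArg PNat.val hd0.symm)
    · exact dvd_of_eq (congrArg PNat.val hd1.symm)
    · exact hd2 ▸ Dvd.intro_left 3 rfl
  have hd : ∀ m, 2 ≤ (d m : ℕ) := by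
    intro m
    fin_cases m
    · exact hd0 ▸ hn0
    · exact hd1 ▸ hn1
    · have := (n 2).pos
      change 2 ≤ (d 2 : ℕ)
      omega
  have hcard : Fintype.card (Site d) = 3 * Fintype.card (Site n) := by
    rw [Fintype.card_pi, Fintype.card_pi, Fin.prod_univ_three, Fin.prod_univ_three]
    simp only [ZMod.card, hd0, hd1, hd2]
    ring
  have h := shift_one_sub_mem_of_two_le M hd _ (pull_mem_logicalSpace hdvd hc)
  have h' := Submodule.mem_map_of_mem (f := push (ZMod 2) (reduce hdvd)) h
  rw [map_push_stabSpace, map_sub, push_shift, reduce_along,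
    push_pull_of_odd (reduce_surjective hdvd) (by decide) hcard] at h'
  exact h'

theorem shift_along_sub_mem (M : Model v) (hn0 : 2 ≤ (n 0 : ℕ)) (hn1 : 2 ≤ (n 1 : ℕ)) (k : ℕ)
    {c : Site n → Cell v} (hc : c ∈ logicalSpace M.terms n) :
    shift (ZMod 2) (along n k) c - c ∈ stabSpace M.terms n := by
  have := shift_nsmul_sub_mem (fun t p hp => shift_mem_stabSpace t hp)
    (shift_one_sub_mem M hn0 hn1 c hc) k
  rwa [nsmul_along, mul_one] at this

end Covers

end STS

/-! ### Operators on a plane as walks of columns -/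

namespace STS

section Plane

variable {v : ℕ} {n : Fin 3 → ℕ+} {terms : Set (Pauli (Corner × Fin v))}

set_option synthInstance.maxSize 512

/-- The Pauli operators, up to phase, on a column of a plane: the composite particles with fixed
first and third coordinates. -/
abbrev Column (v : ℕ) (n : Fin 3 → ℕ+) : Type := ZMod (n 1 : ℕ) → Cell v

/-- The configuration on the plane of third coordinate zero with the given columns. -/
def plane (w : ZMod (n 0 : ℕ) → Column v n) : Site n → Cell v :=
  fun s => if s 2 = 0 then w (s 0) (s 1) else 0

theorem plane_add (w w' : ZMod (n 0 : ℕ) → Column v n) : plane (w + w') = plane w + plane w' := by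
  ext1 s
  by_cases h : s 2 = 0 <;> simp [plane, h]

theorem plane_sub (w w' : ZMod (n 0 : ℕ) → Column v n) : plane (w - w') = plane w - plane w' := by
  ext1 s
  by_cases h : s 2 = 0 <;> simp [plane, h]

theorem shift_along_plane (k : ℕ) (w : ZMod (n 0 : ℕ) → Column v n) :
    shift (ZMod 2) (along n k) (plane w) = plane (shift (ZMod 2) (k : ZMod (n 0 : ℕ)) w) := by
  ext1 s
  simp [plane, along]

/-- The site with the given coordinates. -/
def siteOf (n : Fin 3 → ℕ+) (j : ZMod (n 0 : ℕ)) (y : ZMod (n 1 : ℕ)) (z : ZMod (n 2 : ℕ)) : Site n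
  | 0 => j
  | 1 => y
  | 2 => z

theorem exists_plane_eq {p : Site n → Cell v} (hp : ∀ s : Site n, s 2 ≠ 0 → p s = 0) :
    ∃ w, plane w = p := by
  refine ⟨fun j y => p (siteOf n j y 0), ?_⟩
  ext1 s
  by_cases h : s 2 = 0
  · simp only [plane, h, if_true]
    congr 1
    ext m
    fin_cases m
    · rfl
    · rfl
    · exact h.symm
  · rw [hp s h, plane, if_neg h]

/-- The operator which two neighbouring columns, in the plane of third coordinate zero, have at the
corner `c` of a block whose corner `0` has the first coordinate of the first column and second and
third coordinates `y` and `z`. -/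
def cornerValue (v : ℕ) (n : Fin 3 → ℕ+) (c : Corner) (y : ZMod (n 1 : ℕ)) (z : ZMod (n 2 : ℕ)) :
    Column v n × Column v n →ₗ[ZMod 2] Cell v :=
  if z + ((c 2 : ℕ) : ZMod (n 2 : ℕ)) = 0 then
    (LinearMap.proj (y + ((c 1 : ℕ) : ZMod (n 1 : ℕ)))).comp
      (if c 0 = 0 then LinearMap.fst _ _ _ else LinearMap.snd _ _ _)
  else 0

/-- The pairs of neighbouring columns in a plane which commute with all translates of the
interaction terms. -/
def columnRel (terms : Set (Pauli (Corner × Fin v))) (n : Fin 3 → ℕ+) :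
    Submodule (ZMod 2) (Column v n × Column v n) where
  carrier := {p | ∀ g ∈ terms, ∀ y z,
    ∑ c, cellForm v (fun i => (g.x (c, i), g.z (c, i))) (cornerValue v n c y z p) = 0}
  zero_mem' := by intro g _ y z; simp
  add_mem' := by
    intro p q hp hq g hg y z
    simp only [map_add, Finset.sum_add_distrib]
    rw [hp g hg, hq g hg, add_zero]
  smul_mem' := by
    intro a p hp g hg y z
    simp only [map_smul, ← Finset.smul_sum]
    rw [hp g hg, smul_zero]

theorem latticeForm_termConfig_plane (g : Pauli (Corner × Fin v)) (r : Site n)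
    (w : ZMod (n 0 : ℕ) → Column v n) :
    latticeForm (Site n) (cellForm v) (termConfig n g r) (plane w) =
      ∑ c, cellForm v (fun i => (g.x (c, i), g.z (c, i)))
        (cornerValue v n c (r 1) (r 2) (w (r 0), w (r 0 + 1))) := by
  rw [termConfig, map_sum, LinearMap.sum_apply]
  refine Finset.sum_congr rfl fun c _ => ?_
  rw [latticeForm_single_left]
  congr 1
  have hval : plane w (r + offset n c) = if r 2 + ((c 2 : ℕ) : ZMod (n 2 : ℕ)) = 0 then
      w (r 0 + ((c 0 : ℕ) : ZMod (n 0 : ℕ))) (r 1 + ((c 1 : ℕ) : ZMod (n 1 : ℕ))) else 0 := rfl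
  rw [hval, cornerValue]
  by_cases h1 : r 2 + ((c 2 : ℕ) : ZMod (n 2 : ℕ)) = 0
  · rw [if_pos h1, if_pos h1]
    have h2 : c 0 = 0 ∨ c 0 = 1 := by omega
    rcases h2 with h2 | h2 <;> simp [h2]
  · rw [if_neg h1, if_neg h1]
    rfl

theorem plane_mem_logicalSpace_iff {w : ZMod (n 0 : ℕ) → Column v n} :
    plane w ∈ logicalSpace terms n ↔ ∀ j, (w j, w (j + 1)) ∈ columnRel terms n := by
  rw [mem_logicalSpace_iff]
  constructor
  · intro h j g hg y z
    rw [← h g hg (siteOf n j y z), latticeForm_termConfig_plane]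
    rfl
  · intro h g hg r
    rw [latticeForm_termConfig_plane]
    exact h _ g hg _ _

/-- The difference of the unit translation of columns in the second direction and the identity. -/
def columnDiff (v : ℕ) (n : Fin 3 → ℕ+) : Column v n →ₗ[ZMod 2] Column v n :=
  shift (ZMod 2) 1 - LinearMap.id

theorem columnDiff_mem_columnRel {p : Column v n × Column v n} (hp : p ∈ columnRel terms n) :
    (columnDiff v n p.1, columnDiff v n p.2) ∈ columnRel terms n := by
  refine (columnRel terms n).sub_mem
    (x := (shift (ZMod 2) 1 p.1, shift (ZMod 2) 1 p.2)) (fun g hg y z => ?_) hp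
  rw [← hp g hg (y - 1) z]
  refine Finset.sum_congr rfl fun c _ => ?_
  congr 1
  rw [cornerValue, cornerValue]
  split_ifs <;> simp [sub_add_eq_add_sub]

/-- In a plane whose width is a power of two, `T - 1` is nilpotent, as
`(T - 1) ^ (2 ^ m) = T ^ (2 ^ m) - 1`. -/
theorem isNilpotent_columnDiff {m : ℕ} (hm : (n 1 : ℕ) = 2 ^ m) :
    IsNilpotent (columnDiff v n) := by
  have hpow : ∀ k, ((columnDiff v n) ^ (2 ^ k)) =
      shift (ZMod 2) ((2 ^ k : ℕ) : ZMod (n 1 : ℕ)) - LinearMap.id := by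
    intro k
    induction k with
    | zero => simp [columnDiff]
    | succ k ih =>
      rw [pow_succ, pow_mul, ih, pow_two]
      refine LinearMap.ext fun x => ?_
      simp only [Module.End.mul_apply, LinearMap.sub_apply, LinearMap.id_apply, map_sub,
        shift_shift]
      rw [← Nat.cast_add, ← mul_two, ZModModule.sub_eq_add, ZModModule.sub_eq_add,
        ZModModule.sub_eq_add, ZModModule.sub_eq_add, add_assoc, ← add_assoc _ _ x,
        ZModModule.add_self, zero_add]
  refine ⟨2 ^ m, ?_⟩
  rw [hpow, ← hm, ZMod.natCast_self]
  refine LinearMap.ext fun x => ?_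
  simp [shift_zero]

theorem finrank_ker_columnDiff_le :
    Module.finrank (ZMod 2) (LinearMap.ker (columnDiff v n)) ≤ 2 * v := by
  let f : Cell v →ₗ[ZMod 2] Column v n := LinearMap.pi fun _ => LinearMap.id
  have hle : LinearMap.ker (columnDiff v n) ≤ LinearMap.range f := by
    intro x hx
    have hx1 : ∀ a, x (a - 1) = x a := fun a =>
      congrFun (sub_eq_zero.1 (show shift (ZMod 2) 1 x - x = 0 from hx)) a
    refine ⟨x 0, ?_⟩
    ext1 a
    have : ∀ k : ℕ, x (k : ZMod (n 1 : ℕ)) = x 0 := by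
      intro k
      induction k with
      | zero => simp
      | succ k ih => rw [← hx1, Nat.cast_succ, add_sub_cancel_right, ih]
    rw [← ZMod.natCast_zmod_val a, this]
    rfl
  refine (Submodule.finrank_mono hle).trans ((LinearMap.finrank_range_le f).trans ?_)
  rw [finrank_cell]

/-- The sequence of columns around the torus read off from a bi-infinite sequence. -/
def wrap (n : Fin 3 → ℕ+) (x : ℤ → Column v n) : ZMod (n 0 : ℕ) → Column v n :=
  fun j => x (j.val : ℤ)

theorem val_add_one_cases {N : ℕ} [NeZero N] (j : ZMod N) :
    (j.val + 1 < N ∧ (j + 1).val = j.val + 1) ∨ (j.val + 1 = N ∧ (j + 1).val = 0) := by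
  have h1 : (j + 1).val = (j.val + 1) % N := by
    rw [ZMod.val_add, ZMod.val_one_eq_one_mod, Nat.add_mod_mod]
  have h2 := ZMod.val_lt j
  rcases Nat.lt_or_ge (j.val + 1) N with h | h
  · exact Or.inl ⟨h, by rw [h1, Nat.mod_eq_of_lt h]⟩
  · have h3 : j.val + 1 = N := by omega
    exact Or.inr ⟨h3, by rw [h1, h3, Nat.mod_self]⟩

theorem wrap_mem_columnRel {x : ℤ → Column v n}
    (hx : x ∈ finiteWalk (columnRel terms n) ((n 0 : ℕ) - 1)) (j : ZMod (n 0 : ℕ)) :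
    (wrap n x j, wrap n x (j + 1)) ∈ columnRel terms n := by
  rw [wrap, wrap]
  rcases val_add_one_cases j with ⟨-, h⟩ | ⟨h1, h⟩
  · rw [h, Nat.cast_succ]
    exact hx.1 _
  · rw [h, hx.2 j.val (Or.inr (by omega)), ← hx.2 (-1) (Or.inl (by omega))]
    exact hx.1 (-1)

/-- No term is moved across the seam of the torus, as `x` vanishes at both `-1` and `n 0 - 1`. -/
theorem wrap_shift {x : ℤ → Column v n}
    (hx : x ∈ finiteWalk (columnRel terms n) ((n 0 : ℕ) - 1)) :
    wrap n (shift (ZMod 2) 1 x) = shift (ZMod 2) 1 (wrap n x) := by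
  ext1 j
  obtain ⟨j, rfl⟩ : ∃ i, i + 1 = j := ⟨j - 1, sub_add_cancel j 1⟩
  rw [shift_apply, add_sub_cancel_right, wrap, wrap, shift_apply]
  rcases val_add_one_cases j with ⟨-, h⟩ | ⟨h1, h⟩
  · rw [h, Nat.cast_succ, add_sub_cancel_right]
  · rw [h, hx.2 j.val (Or.inr (by omega)), hx.2 _ (Or.inl (by simp))]

/-- A sequence of columns around the torus with a zero column unrolls to a finite walk. -/
theorem exists_wrap_eq {w : ZMod (n 0 : ℕ) → Column v n}
    (hw : ∀ j, (w j, w (j + 1)) ∈ columnRel terms n) {i : ZMod (n 0 : ℕ)} (hi : w i = 0) :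
    ∃ x ∈ finiteWalk (columnRel terms n) ((n 0 : ℕ) - 1),
      shift (ZMod 2) (i + 1) (wrap n x) = w := by
  have hpos := (n 0).pos
  have hend : i + 1 + (((n 0 : ℕ) - 1 : ℕ) : ZMod (n 0 : ℕ)) = i := by
    rw [Nat.cast_sub hpos]
    simp
  refine ⟨fun t => if 0 ≤ t ∧ t < (n 0 : ℕ) - 1 then w (i + 1 + (t : ZMod (n 0 : ℕ))) else 0,
    ⟨fun t => ?_, fun t ht => ?_⟩, ?_⟩
  · dsimp only
    have h := hw (i + 1 + (t : ZMod (n 0 : ℕ)))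
    rw [add_assoc (i + 1)] at h
    have hcast : ((t + 1 : ℤ) : ZMod (n 0 : ℕ)) = (t : ZMod (n 0 : ℕ)) + 1 := by push_cast; rfl
    rw [hcast]
    by_cases h1 : 0 ≤ t ∧ t < (n 0 : ℕ) - 1
    · rw [if_pos h1]
      by_cases h2 : 0 ≤ t + 1 ∧ t + 1 < (n 0 : ℕ) - 1
      · rw [if_pos h2]; exact h
      · rw [if_neg h2]
        have h3 : t + 1 = (((n 0 : ℕ) - 1 : ℕ) : ℤ) := by omega
        rw [← hcast, h3, Int.cast_natCast, hend, hi] at h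
        exact h
    · rw [if_neg h1]
      by_cases h2 : 0 ≤ t + 1 ∧ t + 1 < (n 0 : ℕ) - 1
      · rw [if_pos h2]
        have h3 : t = -1 := by omega
        subst h3
        simp only [Int.cast_neg, Int.cast_one, neg_add_cancel, add_zero,
          add_neg_cancel_right, hi] at h ⊢
        exact h
      · rw [if_neg h2]; exact Submodule.zero_mem _
  · exact if_neg (by omega)
  · ext1 j
    rw [shift_apply, wrap]
    have hlt := ZMod.val_lt (j - (i + 1))
    have hval : i + 1 + (((j - (i + 1)).val : ℤ) : ZMod (n 0 : ℕ)) = j := by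
      rw [Int.cast_natCast, ZMod.natCast_zmod_val, add_sub_cancel]
    split_ifs with h
    · rw [hval]
    · have h3 : (j - (i + 1)).val = (n 0 : ℕ) - 1 := by omega
      rw [h3, Int.cast_natCast, hend] at hval
      rw [← hval, hi]

/-- Among enough consecutive columns two are equal, and the stretch between them repeats to a
sequence of columns with the corresponding period. -/
theorem exists_periodic_walk {w : ZMod (n 0 : ℕ) → Column v n}
    (hw : ∀ j, (w j, w (j + 1)) ∈ columnRel terms n)
    (hn : ∀ β : ℕ, 0 < β → β ≤ Fintype.card (Column v n) → β ∣ n 0) :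
    ∃ (w' : ZMod (n 0 : ℕ) → Column v n) (i : ZMod (n 0 : ℕ)) (β : ℕ),
      (∀ j, (w' j, w' (j + 1)) ∈ columnRel terms n) ∧ w i = w' i ∧ 0 < β ∧
        β ≤ Fintype.card (Column v n) ∧ ∀ j, w' (j - (β : ZMod (n 0 : ℕ))) = w' j := by
  obtain ⟨a, b, hab, hwab⟩ : ∃ a b : Fin (Fintype.card (Column v n) + 1), a < b ∧
      w ((a : ℕ) : ZMod (n 0 : ℕ)) = w ((b : ℕ) : ZMod (n 0 : ℕ)) := by
    obtain ⟨a, b, hne, h⟩ := Fintype.exists_ne_map_eq_of_card_lt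
      (fun a : Fin (Fintype.card (Column v n) + 1) => w ((a : ℕ) : ZMod (n 0 : ℕ))) (by simp)
    rcases lt_or_gt_of_ne hne with h' | h'
    · exact ⟨a, b, h', h⟩
    · exact ⟨b, a, h', h.symm⟩
  obtain ⟨β, hβ⟩ : ∃ β : ℕ, (b : ℕ) = a + β := ⟨b - a, by have := Fin.lt_def.1 hab; omega⟩
  have hβ0 : 0 < β := by have := Fin.lt_def.1 hab; omega
  have hβle : β ≤ Fintype.card (Column v n) := by have := b.2; omega
  have : NeZero β := ⟨hβ0.ne'⟩
  let φ := ZMod.castHom (hn β hβ0 hβle) (ZMod β)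
  refine ⟨fun j => w ((a : ℕ) + ((φ (j - (a : ℕ))).val : ZMod (n 0 : ℕ))), (a : ℕ), β,
    fun j => ?_, ?_, hβ0, hβle, fun j => ?_⟩
  · have h1 : φ (j + 1 - (a : ℕ)) = φ (j - (a : ℕ)) + 1 := by
      rw [add_sub_right_comm, map_add, map_one]
    dsimp only
    rw [h1]
    have h := hw ((a : ℕ) + ((φ (j - (a : ℕ))).val : ZMod (n 0 : ℕ)))
    rw [add_assoc, ← Nat.cast_succ] at h
    rcases val_add_one_cases (φ (j - (a : ℕ))) with ⟨-, h2⟩ | ⟨h2, h3⟩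
    · rw [h2]; exact h
    · rw [Nat.succ_eq_add_one, h2, ← Nat.cast_add (a : ℕ) β, ← hβ, ← hwab] at h
      rw [h3, Nat.cast_zero, add_zero]
      exact h
  · simp
  · have h1 : φ (j - (β : ZMod (n 0 : ℕ)) - (a : ℕ)) = φ (j - (a : ℕ)) := by
      rw [sub_right_comm, map_sub, map_natCast, ZMod.natCast_self, sub_zero]
    dsimp only
    rw [h1]

theorem card_column (v : ℕ) (n : Fin 3 → ℕ+) :
    Fintype.card (Column v n) = 2 ^ (2 * (n 1 : ℕ) * v) := by
  rw [Fintype.card_fun, Fintype.card_fun, Fintype.card_prod, ZMod.card, ZMod.card, ← pow_mul,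
    show 2 * 2 = 2 ^ 2 from rfl, ← pow_mul]
  rw [Fintype.card_fin]
  congr 1
  ring

/-- The decomposition for operators up to phase. Subtracting a periodic operator leaves a walk of
columns with a zero; this walk is a short one up to a difference `T b - b`, which is a
stabilizer. -/
theorem exists_plane_decomposition (M : Model v) {m : ℕ} (hn0 : 2 ≤ (n 0 : ℕ))
    (hn1 : 2 ≤ (n 1 : ℕ)) (hn₂ : (n 1 : ℕ) = 2 ^ m)
    (hdvd : ∀ β : ℕ, 0 < β → β ≤ Fintype.card (Column v n) → β ∣ n 0)
    {w : ZMod (n 0 : ℕ) → Column v n} (hw : plane w ∈ logicalSpace M.terms n) :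
    ∃ wa wb : ZMod (n 0 : ℕ) → Column v n, plane wa ∈ logicalSpace M.terms n ∧
      plane wb ∈ logicalSpace M.terms n ∧
      plane w - (plane wa + plane wb) ∈ stabSpace M.terms n ∧
      (∀ j : ZMod (n 0 : ℕ), 2 * v ≤ j.val → wa j = 0) ∧
      ∃ β : ℕ, 0 < β ∧ β ≤ Fintype.card (Column v n) ∧
        ∀ j, wb (j - (β : ZMod (n 0 : ℕ))) = wb j := by
  have hwalk := plane_mem_logicalSpace_iff.1 hw
  obtain ⟨w', i, β, hw', hi, hβ0, hβ, hper⟩ := exists_periodic_walk hwalk hdvd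
  have hdiff : ∀ j, ((w - w') j, (w - w') (j + 1)) ∈ columnRel M.terms n := by
    intro j
    rw [Pi.sub_apply, Pi.sub_apply, ← Prod.mk_sub_mk]
    exact Submodule.sub_mem _ (hwalk j) (hw' j)
  obtain ⟨x, hx, hxw⟩ := exists_wrap_eq hdiff (i := i) (by rw [Pi.sub_apply, hi, sub_self])
  have hmono := finiteWalk_mono (R := columnRel M.terms n) (Nat.sub_le ((n 0 : ℕ) - 1) 1)
  obtain ⟨y, hy, b, hb, hxy⟩ : ∃ y ∈ finiteWalk (columnRel M.terms n) (2 * v),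
      ∃ b ∈ finiteWalk (columnRel M.terms n) ((n 0 : ℕ) - 1 - 1),
        x = y + (shift (ZMod 2) 1 b - b) :=
    exists_finiteWalk_add_shift_sub (isNilpotent_columnDiff hn₂)
      (fun p hp => columnDiff_mem_columnRel hp) finrank_ker_columnDiff_le _ x hx
  have hb' := hmono hb
  have hwrap : wrap n x = wrap n y + (shift (ZMod 2) 1 (wrap n b) - wrap n b) := by
    rw [← wrap_shift hb', hxy]
    ext1 j
    simp only [wrap, Pi.add_apply, Pi.sub_apply]
  have hxC : plane (wrap n x) ∈ logicalSpace M.terms n :=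
    plane_mem_logicalSpace_iff.2 (wrap_mem_columnRel hx)
  have hbC : plane (wrap n b) ∈ logicalSpace M.terms n :=
    plane_mem_logicalSpace_iff.2 (wrap_mem_columnRel hb')
  have h1 := shift_along_sub_mem M hn0 hn1 1 hbC
  have h2 := shift_along_sub_mem M hn0 hn1 (i + 1).val hxC
  rw [shift_along_plane, Nat.cast_one] at h1
  rw [shift_along_plane, ZMod.natCast_zmod_val, hxw] at h2
  rw [← plane_sub] at h1 h2
  have hyC : plane (wrap n y) ∈ logicalSpace M.terms n := by
    have h3 : wrap n y = wrap n x - (shift (ZMod 2) 1 (wrap n b) - wrap n b) := by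
      rw [hwrap, add_sub_cancel_right]
    rw [h3, plane_sub, plane_sub]
    refine Submodule.sub_mem _ hxC (Submodule.sub_mem _ ?_ hbC)
    have h4 := shift_mem_logicalSpace (along n 1) hbC
    rwa [shift_along_plane, Nat.cast_one] at h4
  refine ⟨wrap n y, w', hyC, plane_mem_logicalSpace_iff.2 hw', ?_, fun j hj => ?_, β, hβ0, hβ,
    hper⟩
  · have h3 := Submodule.add_mem _ h2 h1
    rw [← plane_add] at h3
    rw [← plane_add, ← plane_sub]
    convert h3 using 2
    rw [hwrap]
    abel
  · exact hy.2 _ (Or.inr (by exact_mod_cast hj))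

theorem supportedOn_of_config {U : Pauli (Qubit v n)} {R : Set (Site n)}
    (h : ∀ s ∉ R, config U s = 0) : SupportedOn U R := fun q hq =>
  ⟨congrArg Prod.fst (congrFun (h q.1 hq) q.2), congrArg Prod.snd (congrFun (h q.1 hq) q.2)⟩

theorem iterate_translate_ofConfig (β : ℕ) (p : Site n → Cell v) :
    (translate 0)^[β] (ofConfig p) = ofConfig (shift (ZMod 2) (along n β) p) := by
  induction β with
  | zero => simp [along, shift_zero]
  | succ β ih =>
    rw [Function.iterate_succ_apply', ih, add_comm β, along_add, ← shift_shift]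
    simp [translate, ofConfig, along]

end Plane

end STS

theorem mainTheorem2 (v : ℕ) (M : STS.Model v) (m : ℕ) (hm : 0 < m) (n : Fin 3 → ℕ+)
    (hn₂ : (n 1 : ℕ) = 2 ^ m)
    (hn₁ : (n 0 : ℕ) = 2 * Nat.factorial (2 ^ (2 * (n 1 : ℕ) * v)))
    (ℓ : STS.Pauli (STS.Qubit v n)) (hℓ : ℓ ∈ M.logical n)
    (hsupp : STS.SupportedOn ℓ (STS.region n (n 0) (n 1) 1)) :
    ∃ ℓa ∈ M.centralizerOn n (STS.region n (n 0) (n 1) 1),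
      ∃ ℓb ∈ M.centralizerOn n (STS.region n (n 0) (n 1) 1),
        M.Equivalent n ℓ (ℓa * ℓb) ∧
        STS.SupportedOn ℓa (STS.region n (2 * v) (n 1) 1) ∧
        ∃ β : ℕ, 0 < β ∧ β ≤ 2 ^ (2 * (n 1 : ℕ) * v) ∧
          (STS.translate 0)^[β] ℓb = ℓb := by
  have hn0 : 2 ≤ (n 0 : ℕ) := by
    rw [hn₁]; have := Nat.factorial_pos (2 ^ (2 * (n 1 : ℕ) * v)); omega
  have hn1 : 2 ≤ (n 1 : ℕ) := by
    rw [hn₂]; exact Nat.le_self_pow hm.ne' 2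
  obtain ⟨w, hw⟩ : ∃ w, STS.plane w = STS.config ℓ := STS.exists_plane_eq fun s hs => by
    have hs' : s ∉ STS.region n (n 0) (n 1) 1 := fun h => hs (by
      rw [← ZMod.val_eq_zero]; exact Nat.lt_one_iff.1 h.2.2)
    ext i
    · exact (hsupp (s, i) hs').1
    · exact (hsupp (s, i) hs').2
  obtain ⟨wa, wb, ha, hb, hS, hsa, β, hβ0, hβ, hper⟩ :=
    STS.exists_plane_decomposition (w := w) M hn0 hn1 hn₂
      (by
        intro β h0 hβ
        rw [STS.card_column] at hβ
        rw [hn₁]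
        exact (Nat.dvd_factorial h0 hβ).mul_left 2)
      (hw ▸ (STS.mem_centralizer_iff M).1 hℓ.1)
  obtain ⟨U, hU, hUw⟩ := STS.exists_mem_stabilizer hS
  rw [hw] at hUw
  -- the phase of the first factor makes the two sides agree exactly, not only up to phase
  have hconf : STS.config (ℓ * U) =
      STS.config (STS.ofConfig (STS.plane wa) * STS.ofConfig (STS.plane wb)) := by
    rw [STS.config_mul, hUw, STS.config_mul, STS.config_ofConfig, STS.config_ofConfig,
      ZModModule.sub_eq_add, ← add_assoc, ZModModule.add_self, zero_add]
  have hphase := STS.eq_scalar_mul_of_config_eq hconf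
  set c := (ℓ * U).phase -
    (STS.ofConfig (STS.plane wa) * STS.ofConfig (STS.plane wb)).phase
  have hca : STS.config (STS.Pauli.scalar c * STS.ofConfig (STS.plane wa)) = STS.plane wa := by
    rw [STS.config_mul, STS.config_scalar, zero_add, STS.config_ofConfig]
  have hsa' : STS.SupportedOn (STS.Pauli.scalar c * STS.ofConfig (STS.plane wa))
      (STS.region n (2 * v) (n 1) 1) := by
    refine STS.supportedOn_of_config fun s hs => ?_
    rw [hca, STS.plane]
    split_ifs with h
    · rw [hsa (s 0)]
      · rfl
      · by_contra hlt
        exact hs ⟨not_le.1 hlt, ZMod.val_lt _, by rw [h, ZMod.val_zero]; exact one_pos⟩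
    · rfl
  have hplane : ∀ W : STS.Pauli (STS.Qubit v n), ∀ u, STS.config W = STS.plane u →
      STS.SupportedOn W (STS.region n (n 0) (n 1) 1) := by
    intro W u hW
    refine STS.supportedOn_of_config fun s hs => ?_
    rw [hW, STS.plane, if_neg]
    exact fun h => hs ⟨ZMod.val_lt _, ZMod.val_lt _, by rw [h, ZMod.val_zero]; exact one_pos⟩
  refine ⟨_, ⟨(STS.mem_centralizer_iff M).2 (hca.symm ▸ ha), hplane _ wa hca⟩,
    STS.ofConfig (STS.plane wb), ⟨(STS.mem_centralizer_iff M).2 hb, hplane _ wb rfl⟩, ?_, hsa',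
    β, hβ0, STS.card_column v n ▸ hβ, ?_⟩
  · rw [STS.Model.Equivalent, mul_assoc, ← hphase, inv_mul_cancel_left]
    exact hU
  · rw [STS.iterate_translate_ofConfig, STS.shift_along_plane]
    congr 2
    exact funext hper
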